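/- Let $\pi:\mathbb{R}^d\to(0,\infty)$ be a probability density with $\log\pi$ differentiable, and let $G(\theta,\mathcal U)$ be a (jointly measurable) unbiased estimate of $\nabla\log\pi(\theta)$: $\mathbb{E}[H(\theta,\mathcal U)]=0$ for every $\theta$, where $H(\theta,\mathcal U)=G(\theta,\mathcal U)-\nabla\log\pi(\theta)$ and $\mathcal U$ is an auxiliary random variable. Assume that the drift $\theta\mapsto\frac12\nabla\log\pi(\theta)$ is continuous and that there is a function $V:\mathbb{R}^d\to[1,\infty)$, tending to infinity as $\|\theta\|\to\infty$, twice differentiable with bounded second derivatives, such that 1. for some exponent $p_H\ge 2$ and some constant $C>0$, $\mathbb{E}\big[\|H(\theta,\mathcal U)\|^{2p_H}\big]\le C\,V(\theta)^{p_H}$ for all $\theta$; 2. for some constant $C>0$, $\|\nabla V(\theta)\|^2+\|\nabla\log\pi(\theta)\|^2\le C\,V(\theta)$ for all $\theta$; 3. for some $\alpha,\beta>0$, $\frac12\langle\nabla V(\theta),\nabla\log\pi(\theta)\rangle\le-\alpha V(\theta)+\beta$ for all $\theta$. Suppose moreover that the drift $\frac12\nabla\log\pi$ is globally Lipschitz on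 $\mathbb{R}^d$. Fix $\theta_0\in\mathbb{R}^d$ and $T>0$, let $W$ be a standard Brownian motion in $\mathbb{R}^d$, and let $(\mathcal U^{(r)}_k)_{r\ge1,k\ge1}$ be i.i.d. copies of $\mathcal U$, independent of $W$. For each $r$ let $\delta^{(r)}_1,\dots,\delta^{(r)}_{m(r)}>0$ be step-sizes with $\sum_{k=1}^{m(r)}\delta^{(r)}_k=T$, put $T^{(r)}_k=\delta^{(r)}_1+\dots+\delta^{(r)}_k$, $\eta^{(r)}_k=(\delta^{(r)}_k)^{-1/2}\big(W(T^{(r)}_k)-W(T^{(r)}_{k-1})\big)$, and define the SGLD chain by $\theta^{(r)}_0=\theta_0$ and $$\theta^{(r)}_k=\theta^{(r)}_{k-1}+\tfrac12\,\delta^{(r)}_k\,\big\{\nabla\log\pi(\theta^{(r)}_{k-1})+H(\theta^{(r)}_{k-1},\mathcal U^{(r)}_k)\big\}+(\delta^{(r)}_k)^{1/2}\,\eta^{(r)}_k .$$ Let $S^{(r)}:[0,T]\to\mathbb{R}^d$ be its piecewise linear interpolation, $S^{(r)}\big(xT^{(r)}_{k-1}+(1-x)T^{(r)}_k\big)=x\,\theta^{(r)}_{k-1}+(1-x)\,\theta^{(r)}_k$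 for $x\in[0,1]$ and $1\le k\le m(r)$. If $\max_{1\le k\le m(r)}\delta^{(r)}_k\to0$ as $r\to\infty$, then $S^{(r)}$ converges weakly on $\big(C([0,T],\mathbb{R}^d),\|\cdot\|_\infty\big)$ to the Langevin diffusion started at $\theta_0$: the equation $dX_t=\frac12\nabla\log\pi(X_t)\,dt+dW_t$, $X_0=\theta_0$, has a solution on $[0,T]$ driven by $W$, and $S^{(r)}$ converges in distribution to every solution on $[0,T]$ of this equation, on whatever probability space and for whatever standard Brownian motion it is defined. -/

import Mathlib

open MeasureTheory ProbabilityTheory Filter Topology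
open scoped NNReal ENNReal

namespace SGLD

noncomputable section

/-- Path space `C([0,T], ℝ^d)`; its topology is that of the supremum norm. -/
abbrev PathSpace (d : ℕ) (T : ℝ) : Type :=
  C(Set.Icc (0 : ℝ) T, EuclideanSpace ℝ (Fin d))

/-- Path space carries its Borel σ-algebra. -/
instance instMeasurableSpacePathSpace (d : ℕ) (T : ℝ) : MeasurableSpace (PathSpace d T) :=
  borel _

instance instBorelSpacePathSpace (d : ℕ) (T : ℝ) : BorelSpace (PathSpace d T) := ⟨rfl⟩

/-- `W` is a standard Brownian motion in `ℝ^d`: its coordinates are independent standard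
real Brownian motions. -/
structure IsStandardBM {d : ℕ} {Ω : Type*} [MeasurableSpace Ω]
    (W : ℝ≥0 → Ω → EuclideanSpace ℝ (Fin d)) (P : Measure Ω) : Prop where
  measurable : ∀ t, Measurable (W t)
  coord : ∀ i : Fin d, IsBrownianReal (fun t ω ↦ W t ω i) P
  indep : iIndepFun (fun (i : Fin d) (ω : Ω) (t : ℝ≥0) ↦ W t ω i) P

/-- `π` is a positive probability density on `ℝ^d` with respect to Lebesgue measure. -/
structure IsPositiveDensity {d : ℕ} (π : EuclideanSpace ℝ (Fin d) → ℝ) : Prop where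
  pos : ∀ θ, 0 < π θ
  integrable : Integrable π
  integral_eq_one : ∫ θ, π θ = 1

/-- The score `∇ log π`. -/
def gradLog {d : ℕ} (π : EuclideanSpace ℝ (Fin d) → ℝ) (θ : EuclideanSpace ℝ (Fin d)) :
    EuclideanSpace ℝ (Fin d) :=
  gradient (fun x ↦ Real.log (π x)) θ

/-- The drift `½ ∇ log π` of the Langevin diffusion. -/
def drift {d : ℕ} (π : EuclideanSpace ℝ (Fin d) → ℝ) (θ : EuclideanSpace ℝ (Fin d)) :
    EuclideanSpace ℝ (Fin d) :=
  (1 / 2 : ℝ) • gradLog π θ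

/-- `G θ U` is an unbiased estimate of `∇ log π (θ)`, where `U` has law `ν`. -/
structure IsUnbiasedEstimate {d : ℕ} {𝒰 : Type*} [MeasurableSpace 𝒰]
    (π : EuclideanSpace ℝ (Fin d) → ℝ)
    (G : EuclideanSpace ℝ (Fin d) → 𝒰 → EuclideanSpace ℝ (Fin d)) (ν : Measure 𝒰) : Prop where
  measurable : Measurable (Function.uncurry G)
  integrable : ∀ θ, Integrable (G θ) ν
  integral_eq : ∀ θ, ∫ u, G θ u ∂ν = gradLog π θ

/-- The stability assumption for the Lyapunov function `V`, where
`H θ u = G θ u - ∇ log π (θ)` is the error of the stochastic gradient. -/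
structure IsLyapunov {d : ℕ} {𝒰 : Type*} [MeasurableSpace 𝒰]
    (π : EuclideanSpace ℝ (Fin d) → ℝ)
    (G : EuclideanSpace ℝ (Fin d) → 𝒰 → EuclideanSpace ℝ (Fin d)) (ν : Measure 𝒰)
    (V : EuclideanSpace ℝ (Fin d) → ℝ) : Prop where
  one_le : ∀ θ, 1 ≤ V θ
  tendsto_atTop : Tendsto V (cocompact (EuclideanSpace ℝ (Fin d))) atTop
  differentiable : Differentiable ℝ V
  differentiable_fderiv : Differentiable ℝ (fderiv ℝ V)
  bounded_second : ∃ C : ℝ, ∀ θ, ‖fderiv ℝ (fderiv ℝ V) θ‖ ≤ C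
  moment_error : ∃ pH : ℝ, 2 ≤ pH ∧ ∃ C : ℝ, 0 < C ∧ ∀ θ,
    ∫⁻ u, ‖G θ u - gradLog π θ‖ₑ ^ (2 * pH) ∂ν ≤ ENNReal.ofReal (C * V θ ^ pH)
  size : ∃ C : ℝ, 0 < C ∧ ∀ θ, ‖gradient V θ‖ ^ 2 + ‖gradLog π θ‖ ^ 2 ≤ C * V θ
  drift_le : ∃ α β : ℝ, 0 < α ∧ 0 < β ∧ ∀ θ,
    (1 / 2 : ℝ) * inner ℝ (gradient V θ) (gradLog π θ) ≤ -α * V θ + β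

/-- The stability assumption: `log π` is differentiable, the drift `½ ∇ log π` is continuous
and a Lyapunov function exists. -/
def StabilityAssumption {d : ℕ} {𝒰 : Type*} [MeasurableSpace 𝒰]
    (π : EuclideanSpace ℝ (Fin d) → ℝ)
    (G : EuclideanSpace ℝ (Fin d) → 𝒰 → EuclideanSpace ℝ (Fin d)) (ν : Measure 𝒰) : Prop :=
  Differentiable ℝ (fun θ ↦ Real.log (π θ)) ∧ Continuous (drift π) ∧
    ∃ V : EuclideanSpace ℝ (Fin d) → ℝ, IsLyapunov π G ν V

/-- The times `T_k = δ_1 + ⋯ + δ_k`. Step-sizes are indexed from zero here: `δ k` is the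
`(k+1)`-st step-size. -/
def time (δ : ℕ → ℝ) (k : ℕ) : ℝ := ∑ j ∈ Finset.range k, δ j

/-- The largest of the first `m` step-sizes. -/
def mesh (δ : ℕ → ℝ) (m : ℕ) : ℝ := ⨆ k : Fin m, δ k

/-- The normalised increments of `w` (a path of the Brownian motion) over the steps. -/
def noise {d : ℕ} (w : ℝ≥0 → EuclideanSpace ℝ (Fin d)) (δ : ℕ → ℝ) (k : ℕ) :
    EuclideanSpace ℝ (Fin d) :=
  (√(δ k))⁻¹ • (w (time δ (k + 1)).toNNReal - w (time δ k).toNNReal)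

/-- The SGLD recursion with step-sizes `δ`, auxiliary variables `u` and noises `η`
(all indexed from zero). -/
def chain {d : ℕ} {𝒰 : Type*}
    (G : EuclideanSpace ℝ (Fin d) → 𝒰 → EuclideanSpace ℝ (Fin d))
    (θ₀ : EuclideanSpace ℝ (Fin d)) (δ : ℕ → ℝ) (u : ℕ → 𝒰)
    (η : ℕ → EuclideanSpace ℝ (Fin d)) : ℕ → EuclideanSpace ℝ (Fin d)
  | 0 => θ₀
  | k + 1 => chain G θ₀ δ u η k + ((1 / 2 : ℝ) * δ k) • G (chain G θ₀ δ u η k) (u k)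
      + √(δ k) • η k

/-- The continuous path on `[0,T]` that interpolates linearly between the values `θ k` at the
times `T_k`, `k ≤ m`: on the `k`-th step it moves by the elapsed fraction of that step times
`θ (k+1) - θ k`; see `interpolation_apply`. -/
def interpolation {d : ℕ} (T : ℝ) (δ : ℕ → ℝ) (m : ℕ) (θ : ℕ → EuclideanSpace ℝ (Fin d)) :
    PathSpace d T where
  toFun t := θ 0 + ∑ k ∈ Finset.range m,
    (max 0 (min 1 (((t : ℝ) - time δ k) / δ k))) • (θ (k + 1) - θ k)
  continuous_toFun := by fun_prop

theorem time_mono {δ : ℕ → ℝ} {m i j : ℕ} (hδ : ∀ k < m, 0 < δ k) (hij : i ≤ j) (hj : j ≤ m) :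
    time δ i ≤ time δ j := by
  unfold time
  apply Finset.sum_le_sum_of_subset_of_nonneg
  · exact Finset.range_mono hij
  · intro k hk _
    exact (hδ k (lt_of_lt_of_le (Finset.mem_range.1 hk) hj)).le

/-- The interpolated path takes the value `x θ_k + (1 - x) θ_{k+1}` at the time
`x T_k + (1 - x) T_{k+1}`, for `x ∈ [0,1]`. -/
theorem interpolation_apply {d : ℕ} {T : ℝ} {δ : ℕ → ℝ} {m : ℕ}
    (θ : ℕ → EuclideanSpace ℝ (Fin d)) (hδ : ∀ k < m, 0 < δ k) {k : ℕ} (hk : k < m)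
    {x : ℝ} (hx : x ∈ Set.Icc (0 : ℝ) 1)
    (ht : x * time δ k + (1 - x) * time δ (k + 1) ∈ Set.Icc (0 : ℝ) T) :
    interpolation T δ m θ ⟨x * time δ k + (1 - x) * time δ (k + 1), ht⟩
      = x • θ k + (1 - x) • θ (k + 1) := by
  obtain ⟨hx0, hx1⟩ := hx
  have hs : ∀ j, time δ (j + 1) = time δ j + δ j := fun j ↦ Finset.sum_range_succ _ _
  have hδk := hδ k hk
  have key : ∀ n, n ≤ m → θ 0 + ∑ j ∈ Finset.range n,
      (max 0 (min 1 ((x * time δ k + (1 - x) * time δ (k + 1) - time δ j) / δ j))) •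
        (θ (j + 1) - θ j) = if n ≤ k then θ n else x • θ k + (1 - x) • θ (k + 1) := by
    intro n
    induction n with
    | zero => intro _; simp
    | succ n ih =>
      intro hn
      have hδn := hδ n (by omega)
      rw [Finset.sum_range_succ, ← add_assoc, ih (by omega)]
      rcases lt_trichotomy n k with h | h | h
      · have h1 : time δ (n + 1) ≤ time δ k := time_mono hδ h hk.le
        have h2 : 1 ≤ (x * time δ k + (1 - x) * time δ (k + 1) - time δ n) / δ n := by
          rw [le_div_iff₀ hδn, hs k]
          rw [hs n] at h1
          nlinarith
        rw [if_pos h.le, if_pos (Nat.succ_le_of_lt h), min_eq_left h2]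
        simp
      · subst h
        have h2 : (x * time δ n + (1 - x) * time δ (n + 1) - time δ n) / δ n = 1 - x := by
          rw [hs n]
          field_simp
          ring
        rw [if_pos le_rfl, if_neg (by omega), h2, min_eq_right (by linarith),
          max_eq_right (by linarith)]
        module
      · have h1 : time δ (k + 1) ≤ time δ n := time_mono hδ h (by omega)
        have h2 : (x * time δ k + (1 - x) * time δ (k + 1) - time δ n) / δ n ≤ 0 := by
          apply div_nonpos_of_nonpos_of_nonneg _ hδn.le
          rw [hs k] at h1 ⊢
          nlinarith
        rw [if_neg (by omega), if_neg (by omega), max_eq_left ((min_le_right _ _).trans h2)]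
        simp
  have := key m le_rfl
  rw [if_neg (by omega)] at this
  exact this

/-- `X` is, on `[0,T]`, a solution of the Langevin equation
`dX_t = ½ ∇ log π (X_t) dt + dW_t`, `X_0 = θ₀`, driven by the standard Brownian motion `W`.
As the noise is additive, this is an integral equation for the paths. -/
structure IsLangevinDiffusion {d : ℕ} {Ω : Type*} [MeasurableSpace Ω]
    (π : EuclideanSpace ℝ (Fin d) → ℝ) (θ₀ : EuclideanSpace ℝ (Fin d)) (T : ℝ) (hT : 0 ≤ T)
    (P : Measure Ω) (W : ℝ≥0 → Ω → EuclideanSpace ℝ (Fin d)) (X : Ω → PathSpace d T) :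
    Prop where
  brownian : IsStandardBM W P
  measurable : Measurable X
  integral_eq : ∀ᵐ ω ∂P, ∀ t : Set.Icc (0 : ℝ) T,
    X ω t = θ₀ + (∫ s in (0 : ℝ)..t, drift π (X ω (Set.projIcc 0 T hT s)))
      + W (t : ℝ).toNNReal ω

end

end SGLD

namespace SGLD

/-! Because the noise is additive and the drift Lipschitz, the Langevin equation can be solved path
by path: `solutionMap` sends a driving path to the unique solution of the integral equation,
continuously in the supremum norm. This gives existence and, since the law of Brownian motion is
determined, uniqueness in law (`IsLangevinDiffusion.map_eq`). It therefore suffices to compare the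
chain with the solution `X` driven by the same `W`, and there one has uniform convergence in
probability.

Let `M_k` be the accumulated gradient error `∑_{j<k} ½ δ_j H(θ_j, U_j)` (`errorSum`). Then `θ_k -
M_k` follows an Euler-type recursion whose Brownian increments are exactly those of `X`. A discrete
Grönwall argument (`norm_sgld_sub_le`, `dist_interpolation_le`) bounds `‖S - X‖_∞` by a constant
times `max_k ‖M_k‖` plus the oscillation of `X` over the mesh, which vanishes by uniform continuity
of the path.

It remains to make `M` small. The bound on `∇V` makes `√V` Lipschitz, so `V` grows at most
quadratically and `E‖H(θ, U)‖² ≤ C (1 + ‖θ‖²)`. Hence the second moments of the chain are bounded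
uniformly in the step-sizes (`exists_integral_sgld_sq_le`). Since `M` is a martingale, its
increments are orthogonal, so `E‖M_m‖²` is of order `∑ δ_k² ≤ T · mesh`, and Doob's inequality
controls the maximum. Passing to almost surely convergent subsequences turns this into weak
convergence. -/

/-! ### The integral equation, path by path -/

/-- **Grönwall's inequality**, integral form. -/
theorem le_mul_exp_of_le_add_integral {u : ℝ → ℝ} (hu : Continuous u) (hu0 : ∀ t, 0 ≤ u t)
    {c K T : ℝ} (hK : 0 ≤ K)
    (h : ∀ t ∈ Set.Icc (0 : ℝ) T, u t ≤ c + K * ∫ s in (0 : ℝ)..t, u s) :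
    ∀ t ∈ Set.Icc (0 : ℝ) T, u t ≤ c * Real.exp (K * t) := by
  intro t ht
  have hd : ∀ x, HasDerivAt (fun y ↦ ∫ s in (0 : ℝ)..y, u s) (u x) x := fun x ↦
    hu.integral_hasStrictDerivAt 0 x |>.hasDerivAt
  -- Grönwall's differential form is applied to the primitive of `u`, since `u` need not be
  -- differentiable: the primitive starts at `0` and its derivative `u` is at most `K` times it plus
  -- `c`.
  have hg := norm_le_gronwallBound_of_norm_deriv_right_le (f := fun y ↦ ∫ s in (0 : ℝ)..y, u s)
    (f' := u) (δ := 0) (K := K) (ε := c) (a := 0) (b := T)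
    (fun x _ ↦ (hd x).continuousAt.continuousWithinAt) (fun x _ ↦ (hd x).hasDerivWithinAt)
    (by simp) (fun x hx ↦ ?_) t ht
  · have h1 := (h t ht).trans (add_le_add_right
      (mul_le_mul_of_nonneg_left ((le_abs_self _).trans hg) hK) c)
    refine h1.trans (le_of_eq ?_)
    rcases hK.eq_or_lt with hK | hK
    · simp [← hK]
    · rw [gronwallBound_of_K_ne_0 hK.ne']
      field_simp
      simp only [sub_zero]
      ring
  · rw [Real.norm_of_nonneg (hu0 x), Real.norm_of_nonneg
      (intervalIntegral.integral_nonneg hx.1 fun s _ ↦ hu0 s)]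
    linarith [h x ⟨hx.1, hx.2.le⟩]

section SolutionMap

variable {E : Type*} [NormedAddCommGroup E] [NormedSpace ℝ E]

/-- The Picard operator of the integral equation `x = θ₀ + ∫ b (x s) ds + w`. -/
noncomputable def picard {T : ℝ} (hT : 0 ≤ T) {b : E → E} (hb : Continuous b) (θ₀ : E)
    (w x : C(Set.Icc (0 : ℝ) T, E)) : C(Set.Icc (0 : ℝ) T, E) where
  -- `Set.projIcc` extends `x` constantly outside `[0,T]`, so that the integrand is continuous on
  -- the whole line.
  toFun t := θ₀ + (∫ s in (0 : ℝ)..t, b (x (Set.projIcc 0 T hT s))) + w t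
  continuous_toFun := by
    have hc : Continuous fun s ↦ b (x (Set.projIcc 0 T hT s)) := by fun_prop
    have := intervalIntegral.continuous_primitive (μ := volume)
      (fun a b ↦ hc.intervalIntegrable a b) 0
    fun_prop

theorem picard_apply {T : ℝ} (hT : 0 ≤ T) {b : E → E} (hb : Continuous b) (θ₀ : E)
    (w x : C(Set.Icc (0 : ℝ) T, E)) (t : Set.Icc (0 : ℝ) T) :
    picard hT hb θ₀ w x t = θ₀ + (∫ s in (0 : ℝ)..t, b (x (Set.projIcc 0 T hT s))) + w t := rfl

theorem norm_picard_sub_le {T : ℝ} (hT : 0 ≤ T) {b : E → E} {K : ℝ≥0} (hb : LipschitzWith K b)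
    (θ₀ : E) (w w' x y : C(Set.Icc (0 : ℝ) T, E)) (t : Set.Icc (0 : ℝ) T) :
    ‖picard hT hb.continuous θ₀ w x t - picard hT hb.continuous θ₀ w' y t‖ ≤ dist w w' +
      K * ∫ s in (0 : ℝ)..t, ‖x (Set.projIcc 0 T hT s) - y (Set.projIcc 0 T hT s)‖ := by
  have hb' := hb.continuous
  have hcx : Continuous fun s ↦ b (x (Set.projIcc 0 T hT s)) := by fun_prop
  have hcy : Continuous fun s ↦ b (y (Set.projIcc 0 T hT s)) := by fun_prop
  have hcd : Continuous fun s ↦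
    ‖x (Set.projIcc 0 T hT s) - y (Set.projIcc 0 T hT s)‖ := by fun_prop
  have h1 : picard hT hb.continuous θ₀ w x t - picard hT hb.continuous θ₀ w' y t =
      (w t - w' t) + ∫ s in (0 : ℝ)..t,
        (b (x (Set.projIcc 0 T hT s)) - b (y (Set.projIcc 0 T hT s))) := by
    rw [intervalIntegral.integral_sub (hcx.intervalIntegrable _ _) (hcy.intervalIntegrable _ _),
      picard_apply, picard_apply]
    abel
  rw [h1]
  refine (norm_add_le _ _).trans (add_le_add ?_ ?_)
  · rw [← dist_eq_norm]
    exact ContinuousMap.dist_apply_le_dist t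
  · rw [← intervalIntegral.integral_const_mul]
    refine intervalIntegral.norm_integral_le_of_norm_le t.2.1 (ae_of_all _ fun s _ ↦ ?_)
      ((hcd.const_mul _).intervalIntegrable _ _)
    exact hb.norm_sub_le _ _

/-- Each iteration integrates the previous bound once more, which produces the factorial. It makes a
high iterate contract for every `T`, without a smallness condition. -/
theorem norm_picard_iterate_sub_le {T : ℝ} (hT : 0 ≤ T) {b : E → E} {K : ℝ≥0}
    (hb : LipschitzWith K b) (θ₀ : E) (w x y : C(Set.Icc (0 : ℝ) T, E)) (n : ℕ) :
    ∀ t : Set.Icc (0 : ℝ) T, ‖(picard hT hb.continuous θ₀ w)^[n] x t -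
      (picard hT hb.continuous θ₀ w)^[n] y t‖ ≤ (K * t) ^ n / n.factorial * dist x y := by
  induction n with
  | zero => intro t; simpa [dist_eq_norm] using ContinuousMap.dist_apply_le_dist (f := x) (g := y) t
  | succ n ih =>
    intro t
    rw [Function.iterate_succ_apply', Function.iterate_succ_apply']
    refine (norm_picard_sub_le hT hb θ₀ w w _ _ t).trans ?_
    rw [dist_self, zero_add]
    set f := (picard hT hb.continuous θ₀ w)^[n] x
    set g := (picard hT hb.continuous θ₀ w)^[n] y
    have hcd : Continuous fun s ↦
      ‖f (Set.projIcc 0 T hT s) - g (Set.projIcc 0 T hT s)‖ := by fun_prop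
    have hcp : Continuous fun s : ℝ ↦ (K * s) ^ n / n.factorial * dist x y := by fun_prop
    have h1 : ∫ s in (0 : ℝ)..t, ‖f (Set.projIcc 0 T hT s) - g (Set.projIcc 0 T hT s)‖ ≤
        ∫ s in (0 : ℝ)..t, (K * s) ^ n / n.factorial * dist x y := by
      refine intervalIntegral.integral_mono_on t.2.1 (hcd.intervalIntegrable _ _)
        (hcp.intervalIntegrable _ _) fun s hs ↦ ?_
      have hs' : s ∈ Set.Icc 0 T := ⟨hs.1, hs.2.trans t.2.2⟩
      rw [Set.projIcc_of_mem hT hs']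
      exact ih ⟨s, hs'⟩
    refine (mul_le_mul_of_nonneg_left h1 K.coe_nonneg).trans (le_of_eq ?_)
    have h2 : (fun s : ℝ ↦ (K * s) ^ n / n.factorial * dist x y) =
        fun s ↦ ((K : ℝ) ^ n / n.factorial * dist x y) * s ^ n := by
      ext s; rw [mul_pow]; ring
    rw [h2, intervalIntegral.integral_const_mul, integral_pow, Nat.factorial_succ]
    push_cast
    have : (n : ℝ) + 1 ≠ 0 := by positivity
    have : (n.factorial : ℝ) ≠ 0 := by positivity
    field_simp
    simp only [ne_eq, Nat.add_eq_zero_iff, one_ne_zero, and_false, not_false_eq_true, zero_pow,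
      sub_zero]
    ring

/-- Grönwall applied to the difference of two solutions. Used both for continuity in the driving
path and, with `w = w'`, for uniqueness. -/
theorem dist_le_of_eq_picard {T : ℝ} (hT : 0 ≤ T) {b : E → E} {K : ℝ≥0} (hb : LipschitzWith K b)
    {θ₀ : E} {w w' x y : C(Set.Icc (0 : ℝ) T, E)} (hx : picard hT hb.continuous θ₀ w x = x)
    (hy : picard hT hb.continuous θ₀ w' y = y) : dist x y ≤ Real.exp (K * T) * dist w w' := by
  refine (ContinuousMap.dist_le (by positivity)).2 fun t ↦ ?_
  have h := le_mul_exp_of_le_add_integral (T := T)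
    (u := fun s ↦ ‖x (Set.projIcc 0 T hT s) - y (Set.projIcc 0 T hT s)‖) (by fun_prop)
    (fun _ ↦ norm_nonneg _) (c := dist w w') (K := K) K.coe_nonneg (fun s hs ↦ ?_) t t.2
  · simp only [Set.projIcc_val] at h
    rw [dist_eq_norm, mul_comm]
    refine h.trans (mul_le_mul_of_nonneg_left (Real.exp_le_exp.2 ?_) dist_nonneg)
    exact mul_le_mul_of_nonneg_left t.2.2 K.coe_nonneg
  · have := norm_picard_sub_le hT hb θ₀ w w' x y ⟨s, hs⟩
    rw [hx, hy] at this
    simpa only [Set.projIcc_of_mem hT hs] using this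

variable [CompleteSpace E]

theorem exists_eq_picard {T : ℝ} (hT : 0 ≤ T) {b : E → E} {K : ℝ≥0} (hb : LipschitzWith K b)
    (θ₀ : E) (w : C(Set.Icc (0 : ℝ) T, E)) : ∃ x, picard hT hb.continuous θ₀ w x = x := by
  obtain ⟨n, hn⟩ := ((FloorSemiring.tendsto_pow_div_factorial_atTop (K * T : ℝ)).eventually_lt_const
    one_pos).exists
  have h0 : 0 ≤ (K * T : ℝ) ^ n / n.factorial := by positivity
  have hc : ContractingWith ⟨_, h0⟩ (picard hT hb.continuous θ₀ w)^[n] := by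
    refine ⟨by exact_mod_cast hn, LipschitzWith.of_dist_le_mul fun x y ↦ ?_⟩
    refine (ContinuousMap.dist_le (by positivity)).2 fun t ↦ ?_
    rw [dist_eq_norm]
    refine (norm_picard_iterate_sub_le hT hb θ₀ w x y n t).trans ?_
    have h1 : (K * (t : ℝ)) ^ n ≤ (K * T) ^ n := by
      have := t.2.1
      have := t.2.2
      gcongr
    change _ ≤ (K * T : ℝ) ^ n / n.factorial * dist x y
    gcongr
  -- The unique fixed point of an iterate is fixed by the map itself.
  exact ⟨_, hc.isFixedPt_fixedPoint_iterate⟩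

/-- The map that sends a driving path to the solution of the integral equation. -/
noncomputable def solutionMap {T : ℝ} (hT : 0 ≤ T) {b : E → E} {K : ℝ≥0} (hb : LipschitzWith K b)
    (θ₀ : E) (w : C(Set.Icc (0 : ℝ) T, E)) : C(Set.Icc (0 : ℝ) T, E) :=
  (exists_eq_picard hT hb θ₀ w).choose

theorem picard_solutionMap {T : ℝ} (hT : 0 ≤ T) {b : E → E} {K : ℝ≥0} (hb : LipschitzWith K b)
    (θ₀ : E) (w : C(Set.Icc (0 : ℝ) T, E)) :
    picard hT hb.continuous θ₀ w (solutionMap hT hb θ₀ w) = solutionMap hT hb θ₀ w :=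
  (exists_eq_picard hT hb θ₀ w).choose_spec

theorem continuous_solutionMap {T : ℝ} (hT : 0 ≤ T) {b : E → E} {K : ℝ≥0}
    (hb : LipschitzWith K b) (θ₀ : E) : Continuous (solutionMap hT hb θ₀) :=
  LipschitzWith.continuous (K := ⟨Real.exp (K * T), (Real.exp_pos _).le⟩) <|
    LipschitzWith.of_dist_le_mul fun w w' ↦
      dist_le_of_eq_picard hT hb (picard_solutionMap hT hb θ₀ w) (picard_solutionMap hT hb θ₀ w')

theorem eq_solutionMap {T : ℝ} (hT : 0 ≤ T) {b : E → E} {K : ℝ≥0} (hb : LipschitzWith K b)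
    {θ₀ : E} {w x : C(Set.Icc (0 : ℝ) T, E)} (hx : picard hT hb.continuous θ₀ w x = x) :
    x = solutionMap hT hb θ₀ w := by
  refine dist_le_zero.1 ?_
  simpa using dist_le_of_eq_picard hT hb hx (picard_solutionMap hT hb θ₀ w)

end SolutionMap

/-! ### Measurability and laws on path space -/

/-- A continuous injection of a Polish space is a measurable embedding (Lusin–Souslin).
Measurability and laws of random paths can thus be tested at countably many times. -/
theorem measurableEmbedding_eval_denseSeq {d : ℕ} {T : ℝ} [Nonempty (Set.Icc (0 : ℝ) T)] :
    MeasurableEmbedding fun (x : PathSpace d T) (n : ℕ) ↦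
      x (TopologicalSpace.denseSeq (Set.Icc (0 : ℝ) T) n) := by
  refine Continuous.measurableEmbedding (by fun_prop) fun x y hxy ↦ ?_
  refine DFunLike.coe_injective ((TopologicalSpace.denseRange_denseSeq _).equalizer
    x.continuous y.continuous ?_)
  exact hxy

theorem measurable_pathSpace_iff {d : ℕ} {T : ℝ} (hT : 0 ≤ T) {Ω : Type*} [MeasurableSpace Ω]
    {X : Ω → PathSpace d T} : Measurable X ↔ ∀ t, Measurable fun ω ↦ X ω t := by
  have : Nonempty (Set.Icc (0 : ℝ) T) := ⟨⟨0, le_rfl, hT⟩⟩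
  refine ⟨fun h t ↦ ((ContinuousEvalConst.continuous_eval_const t).measurable).comp h,
    fun h ↦ ?_⟩
  rw [← measurableEmbedding_eval_denseSeq.measurable_comp_iff]
  exact measurable_pi_lambda _ fun n ↦ h _

/-- The law of a random path is determined by the law of the process of its values. -/
theorem map_pathSpace_eq {d : ℕ} {T : ℝ} (hT : 0 ≤ T) {Ω Ω' : Type*} [MeasurableSpace Ω]
    [MeasurableSpace Ω'] {P : Measure Ω} {P' : Measure Ω'} {X : Ω → PathSpace d T}
    {X' : Ω' → PathSpace d T} (hX : Measurable X) (hX' : Measurable X')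
    (h : P.map (fun ω t ↦ X ω t) = P'.map (fun ω t ↦ X' ω t)) : P.map X = P'.map X' := by
  have : Nonempty (Set.Icc (0 : ℝ) T) := ⟨⟨0, le_rfl, hT⟩⟩
  have hm : MeasurableEmbedding fun (x : PathSpace d T) (n : ℕ) ↦
      x (TopologicalSpace.denseSeq (Set.Icc (0 : ℝ) T) n) := measurableEmbedding_eval_denseSeq
  have hp : Measurable fun (y : Set.Icc (0 : ℝ) T → EuclideanSpace ℝ (Fin d)) (n : ℕ) ↦
      y (TopologicalSpace.denseSeq (Set.Icc (0 : ℝ) T) n) := by fun_prop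
  have h2 := congrArg (Measure.map fun (y : Set.Icc (0 : ℝ) T → EuclideanSpace ℝ (Fin d)) (n : ℕ) ↦
      y (TopologicalSpace.denseSeq (Set.Icc (0 : ℝ) T) n)) h
  rw [Measure.map_map hp (measurable_pi_lambda _ ((measurable_pathSpace_iff hT).1 hX)),
    Measure.map_map hp (measurable_pi_lambda _ ((measurable_pathSpace_iff hT).1 hX'))] at h2
  refine Measure.ext fun s hs ↦ ?_
  -- Pulling back along the embedding recovers each law from its image on sequences.
  have h3 := hm.comap_map (P.map X)
  have h4 := hm.comap_map (P'.map X')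
  rw [Measure.map_map hm.measurable hX] at h3
  rw [Measure.map_map hm.measurable hX'] at h4
  rw [← h3, ← h4]
  exact congrArg (fun μ ↦ (Measure.comap _ μ) s) h2

/-! ### Brownian paths and uniqueness in law -/

section Langevin

variable {d : ℕ} {Ω Ω' : Type*} [MeasurableSpace Ω] [MeasurableSpace Ω']

/-- Each coordinate has prescribed Gaussian finite-dimensional laws, which fix its law as a
projective limit. Independence makes the joint law the product of these. -/
theorem IsStandardBM.map_eq {P : Measure Ω} {P' : Measure Ω'} [IsProbabilityMeasure P]
    [IsProbabilityMeasure P'] {W : ℝ≥0 → Ω → EuclideanSpace ℝ (Fin d)}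
    {W' : ℝ≥0 → Ω' → EuclideanSpace ℝ (Fin d)} (hW : IsStandardBM W P) (hW' : IsStandardBM W' P') :
    P.map (fun ω t ↦ W t ω) = P'.map (fun ω t ↦ W' t ω) := by
  have hc : ∀ {Ω : Type _} [MeasurableSpace Ω] {P : Measure Ω}
      {W : ℝ≥0 → Ω → EuclideanSpace ℝ (Fin d)} (hW : IsStandardBM W P) (i : Fin d),
      Measurable fun ω t ↦ W t ω i := fun hW i ↦ measurable_pi_lambda _ fun t ↦ by
    have := hW.measurable t
    fun_prop
  have hcoord : ∀ i, P.map (fun ω t ↦ W t ω i) = P'.map (fun ω t ↦ W' t ω i) := fun i ↦ by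
    have h1 := isProjectiveLimit_map (X := fun t ω ↦ W t ω i) (P := P) (hc hW i).aemeasurable
    have h2 := isProjectiveLimit_map (X := fun t ω ↦ W' t ω i) (P := P')
      (measurable_pi_lambda _ fun t ↦ by have := hW'.measurable t; fun_prop).aemeasurable
    have h3 : (fun I : Finset ℝ≥0 ↦ P.map (fun ω ↦ I.restrict (fun t ↦ W t ω i))) =
        fun I ↦ P'.map (fun ω ↦ I.restrict (fun t ↦ W' t ω i)) := by
      ext1 I
      rw [((hW.coord i).hasLaw I).map_eq, ((hW'.coord i).hasLaw I).map_eq]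
    rw [h3] at h1
    have : ∀ I : Finset ℝ≥0, IsFiniteMeasure
      (P'.map (fun ω ↦ I.restrict (fun t ↦ W' t ω i))) := fun I ↦ inferInstance
    exact h1.unique h2
  have hpi : P.map (fun ω (i : Fin d) t ↦ W t ω i) = P'.map (fun ω (i : Fin d) t ↦ W' t ω i) := by
    rw [hW.indep.map_fun_eq_pi_map fun i ↦ (hc hW i).aemeasurable,
      hW'.indep.map_fun_eq_pi_map fun i ↦
      (measurable_pi_lambda _ fun t ↦ by have := hW'.measurable t; fun_prop).aemeasurable]
    exact congrArg Measure.pi (funext hcoord)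
  have hg : Measurable fun (y : Fin d → ℝ≥0 → ℝ) (t : ℝ≥0) ↦
      (WithLp.toLp 2 (fun i ↦ y i t) : EuclideanSpace ℝ (Fin d)) := by fun_prop
  have := congrArg (Measure.map fun (y : Fin d → ℝ≥0 → ℝ) (t : ℝ≥0) ↦
      (WithLp.toLp 2 (fun i ↦ y i t) : EuclideanSpace ℝ (Fin d))) hpi
  rw [Measure.map_map hg (measurable_pi_lambda _ fun i ↦ hc hW i), Measure.map_map hg
    (measurable_pi_lambda _ fun i ↦ measurable_pi_lambda _ fun t ↦ by
      have := hW'.measurable t; fun_prop)] at this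
  exact this

/-- A standard Brownian motion agrees almost surely on `[0,T]` with a random path. -/
theorem IsStandardBM.exists_path {P : Measure Ω} {W : ℝ≥0 → Ω → EuclideanSpace ℝ (Fin d)}
    (hW : IsStandardBM W P) {T : ℝ} (hT : 0 ≤ T) :
    ∃ w : Ω → PathSpace d T, Measurable w ∧
      ∀ᵐ ω ∂P, ∀ t : Set.Icc (0 : ℝ) T, w ω t = W (t : ℝ).toNNReal ω := by
  classical
  have hae : ∀ᵐ ω ∂P, Continuous fun t ↦ W t ω := by
    filter_upwards [ae_all_iff.2 fun i ↦ (hW.coord i).cont] with ω h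
    exact (PiLp.continuous_toLp 2 _).comp (continuous_pi h)
  -- The set of discontinuous paths need not be measurable, so it is enlarged to a measurable null
  -- set, on which the path is set to `0`.
  obtain ⟨s, hs, hsm, hs0⟩ := exists_measurable_superset_of_null (ae_iff.1 hae)
  have hcont : ∀ ω ∉ s, Continuous fun t ↦ W t ω := fun ω hω ↦ by
    by_contra h
    exact hω (hs h)
  let w : Ω → PathSpace d T := fun ω ↦ if h : ω ∈ s then 0 else
    ⟨fun t ↦ W (t : ℝ).toNNReal ω, (hcont ω h).comp (by fun_prop)⟩
  have hw : ∀ ω t, w ω t = if ω ∈ s then 0 else W (t : ℝ).toNNReal ω := fun ω t ↦ by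
    by_cases h : ω ∈ s <;> simp [w, h]
  refine ⟨w, (measurable_pathSpace_iff hT).2 fun t ↦ ?_, ?_⟩
  · simp_rw [hw]
    exact Measurable.ite hsm measurable_const (hW.measurable _)
  · filter_upwards [compl_mem_ae_iff.2 hs0] with ω hω t
    rw [hw, if_neg hω]

theorem IsStandardBM.ae_zero {P : Measure Ω} {W : ℝ≥0 → Ω → EuclideanSpace ℝ (Fin d)}
    (hW : IsStandardBM W P) : ∀ᵐ ω ∂P, W 0 ω = 0 := by
  filter_upwards [ae_all_iff.2 fun i ↦ (hW.coord i).eval_zero_ae_eq_zero] with ω h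
  ext i
  exact h i

theorem IsStandardBM.memLp_two {P : Measure Ω} {W : ℝ≥0 → Ω → EuclideanSpace ℝ (Fin d)}
    (hW : IsStandardBM W P) (t : ℝ≥0) : MemLp (W t) 2 P :=
  MemLp.of_eval_piLp fun i ↦ ((hW.coord i).hasLaw_eval t).hasGaussianLaw.memLp_two

theorem IsStandardBM.integral_norm_sq {P : Measure Ω} [IsProbabilityMeasure P]
    {W : ℝ≥0 → Ω → EuclideanSpace ℝ (Fin d)}
    (hW : IsStandardBM W P) (t : ℝ≥0) : ∫ ω, ‖W t ω‖ ^ 2 ∂P = d * t := by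
  have hm : ∀ i, MemLp (fun ω ↦ W t ω i) 2 P :=
    fun i ↦ ((hW.coord i).hasLaw_eval t).hasGaussianLaw.memLp_two
  simp_rw [EuclideanSpace.norm_sq_eq, Real.norm_eq_abs, sq_abs]
  rw [integral_finsetSum _ fun i _ ↦ (hm i).integrable_sq]
  have : ∀ i, ∫ ω, W t ω i ^ 2 ∂P = t := fun i ↦ by
    have h1 := (hW.coord i).covariance_eval t t
    have h2 := (hW.coord i).integral_eval t
    rw [covariance_self (hm i).aemeasurable, variance_eq_sub (hm i), h2] at h1
    simpa using h1
  simp [this]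

/-- The Langevin diffusion is the image of the Brownian path under the solution map. -/
theorem IsLangevinDiffusion.ae_eq_solutionMap {P : Measure Ω}
    {W : ℝ≥0 → Ω → EuclideanSpace ℝ (Fin d)} {π : EuclideanSpace ℝ (Fin d) → ℝ}
    {θ₀ : EuclideanSpace ℝ (Fin d)} {T : ℝ} {hT : 0 ≤ T} {X : Ω → PathSpace d T} {K : ℝ≥0}
    (hX : IsLangevinDiffusion π θ₀ T hT P W X) (hb : LipschitzWith K (drift π))
    {w : Ω → PathSpace d T} (hw : ∀ᵐ ω ∂P, ∀ t : Set.Icc (0 : ℝ) T, w ω t = W (t : ℝ).toNNReal ω) :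
    X =ᵐ[P] fun ω ↦ solutionMap hT hb θ₀ (w ω) := by
  filter_upwards [hw, hX.integral_eq] with ω h1 h2
  refine eq_solutionMap hT hb (ContinuousMap.ext fun t ↦ ?_)
  rw [picard_apply, h2 t, h1 t]

theorem isLangevinDiffusion_solutionMap {P : Measure Ω}
    {W : ℝ≥0 → Ω → EuclideanSpace ℝ (Fin d)} (hW : IsStandardBM W P)
    {π : EuclideanSpace ℝ (Fin d) → ℝ}
    (θ₀ : EuclideanSpace ℝ (Fin d)) {T : ℝ} (hT : 0 ≤ T) {K : ℝ≥0}
    (hb : LipschitzWith K (drift π)) {w : Ω → PathSpace d T} (hwm : Measurable w)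
    (hw : ∀ᵐ ω ∂P, ∀ t : Set.Icc (0 : ℝ) T, w ω t = W (t : ℝ).toNNReal ω) :
    IsLangevinDiffusion π θ₀ T hT P W fun ω ↦ solutionMap hT hb θ₀ (w ω) where
  brownian := hW
  measurable := (continuous_solutionMap hT hb θ₀).measurable.comp hwm
  integral_eq := by
    filter_upwards [hw] with ω h t
    conv_lhs => rw [← picard_solutionMap hT hb θ₀ (w ω)]
    rw [picard_apply, h t]

/-- Uniqueness in law for the Langevin equation. -/
theorem IsLangevinDiffusion.map_eq {P : Measure Ω} {P' : Measure Ω'} [IsProbabilityMeasure P]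
    [IsProbabilityMeasure P'] {W : ℝ≥0 → Ω → EuclideanSpace ℝ (Fin d)}
    {W' : ℝ≥0 → Ω' → EuclideanSpace ℝ (Fin d)} {π : EuclideanSpace ℝ (Fin d) → ℝ}
    {θ₀ : EuclideanSpace ℝ (Fin d)} {T : ℝ} {hT : 0 ≤ T} {X : Ω → PathSpace d T}
    {X' : Ω' → PathSpace d T} {K : ℝ≥0} (hb : LipschitzWith K (drift π))
    (hX : IsLangevinDiffusion π θ₀ T hT P W X) (hX' : IsLangevinDiffusion π θ₀ T hT P' W' X') :
    P.map X = P'.map X' := by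
  obtain ⟨w, hwm, hw⟩ := hX.brownian.exists_path hT
  obtain ⟨w', hwm', hw'⟩ := hX'.brownian.exists_path hT
  have hΦ := (continuous_solutionMap hT hb θ₀).measurable
  have hlaw : P.map w = P'.map w' := by
    refine map_pathSpace_eq hT hwm hwm' ?_
    rw [Measure.map_congr (g := fun ω (t : Set.Icc (0 : ℝ) T) ↦ W (t : ℝ).toNNReal ω)
      (hw.mono fun ω h ↦ funext h),
      Measure.map_congr (g := fun ω (t : Set.Icc (0 : ℝ) T) ↦ W' (t : ℝ).toNNReal ω)
      (hw'.mono fun ω h ↦ funext h)]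
    have hr : Measurable fun (y : ℝ≥0 → EuclideanSpace ℝ (Fin d)) (t : Set.Icc (0 : ℝ) T) ↦
      y (t : ℝ).toNNReal := by fun_prop
    have := congrArg (Measure.map fun (y : ℝ≥0 → EuclideanSpace ℝ (Fin d))
      (t : Set.Icc (0 : ℝ) T) ↦ y (t : ℝ).toNNReal) (hX.brownian.map_eq hX'.brownian)
    rwa [Measure.map_map hr (measurable_pi_lambda _ hX.brownian.measurable),
      Measure.map_map hr (measurable_pi_lambda _ hX'.brownian.measurable)] at this
  rw [Measure.map_congr (hX.ae_eq_solutionMap hb hw),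
    Measure.map_congr (hX'.ae_eq_solutionMap hb hw')]
  have := congrArg (Measure.map (solutionMap hT hb θ₀)) hlaw
  rwa [Measure.map_map hΦ hwm, Measure.map_map hΦ hwm'] at this

end Langevin

/-! ### Quadratic growth of the gradient error -/

/-- The error `H` of the stochastic gradient. -/
noncomputable def gradError {d : ℕ} {𝒰 : Type*} (π : EuclideanSpace ℝ (Fin d) → ℝ)
    (G : EuclideanSpace ℝ (Fin d) → 𝒰 → EuclideanSpace ℝ (Fin d))
    (θ : EuclideanSpace ℝ (Fin d)) (u : 𝒰) : EuclideanSpace ℝ (Fin d) :=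
  G θ u - gradLog π θ

/-- The hypothesis bounds the derivative `V' / (2√V)` of `√V`, so `√V` is Lipschitz and grows at
most linearly; `V ≥ 1` keeps the square root differentiable. -/
theorem exists_le_mul_one_add_norm_sq {E : Type*} [NormedAddCommGroup E] [NormedSpace ℝ E]
    {V : E → ℝ} (hV : ∀ x, 1 ≤ V x) (hd : Differentiable ℝ V) {C : ℝ}
    (hC : ∀ x, ‖fderiv ℝ V x‖ ^ 2 ≤ C * V x) : ∃ A, 0 ≤ A ∧ ∀ x, V x ≤ A * (1 + ‖x‖ ^ 2) := by
  have hd' : Differentiable ℝ fun x ↦ √(V x) := fun x ↦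
    (hd x).sqrt (by linarith [hV x])
  have hC0 : 0 ≤ C := by
    have := (sq_nonneg _).trans (hC 0)
    have := hV 0
    by_contra h
    nlinarith
  have hb : ∀ x, ‖fderiv ℝ (fun x ↦ √(V x)) x‖ ≤ √C := fun x ↦ by
    have hVx := hV x
    have h0 : 0 < √(V x) := Real.sqrt_pos.2 (by linarith)
    rw [fderiv_sqrt (hd x) (by linarith), norm_smul, Real.norm_of_nonneg (by positivity)]
    have h1 : ‖fderiv ℝ V x‖ ≤ √C * √(V x) := by
      rw [← Real.sqrt_mul hC0]
      exact Real.le_sqrt_of_sq_le (hC x)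
    rw [div_mul_eq_mul_div, one_mul, div_le_iff₀ (by positivity)]
    nlinarith [Real.sqrt_nonneg C, mul_nonneg (Real.sqrt_nonneg C) h0.le]
  have hmv : ∀ x, ‖√(V x) - √(V 0)‖ ≤ √C * ‖x‖ := fun x ↦ by
    simpa using convex_univ.norm_image_sub_le_of_norm_fderiv_le (𝕜 := ℝ)
      (fun y _ ↦ hd' y) (fun y _ ↦ hb y) (Set.mem_univ 0) (Set.mem_univ x)
  refine ⟨2 * V 0 + 2 * C, by linarith [hV 0], fun x ↦ ?_⟩
  have h1 : √(V x) ≤ √(V 0) + √C * ‖x‖ := by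
    linarith [(Real.le_norm_self _).trans (hmv x)]
  have h2 := pow_le_pow_left₀ (Real.sqrt_nonneg _) h1 2
  rw [Real.sq_sqrt (by linarith [hV x])] at h2
  have h3 := Real.sq_sqrt hC0
  have h4 := Real.sq_sqrt (show 0 ≤ V 0 by linarith [hV 0])
  have h5 := sq_nonneg (√(V 0) - √C * ‖x‖)
  have h6 : (√C * ‖x‖) ^ 2 = C * ‖x‖ ^ 2 := by rw [mul_pow, h3]
  nlinarith [mul_nonneg (show 0 ≤ V 0 by linarith [hV 0]) (sq_nonneg ‖x‖)]

/-- Monotonicity of `L^p` norms on a probability space, from exponent `2` to `2p`; squaring turns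
`(C v^p)^(1/(2p))` into `C^(1/p) v`. -/
theorem lintegral_enorm_sq_le {E 𝒰 : Type*} [NormedAddCommGroup E] [MeasurableSpace 𝒰]
    {ν : Measure 𝒰} [IsProbabilityMeasure ν] {f : 𝒰 → E} (hf : AEStronglyMeasurable f ν)
    {p C v : ℝ} (hp : 2 ≤ p) (hC : 0 ≤ C) (hv : 0 ≤ v)
    (h : ∫⁻ u, ‖f u‖ₑ ^ (2 * p) ∂ν ≤ ENNReal.ofReal (C * v ^ p)) :
    ∫⁻ u, ‖f u‖ₑ ^ (2 : ℝ) ∂ν ≤ ENNReal.ofReal (C ^ (1 / p) * v) := by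
  have h1 := eLpNorm'_le_eLpNorm'_of_exponent_le (p := 2) (q := 2 * p) (by norm_num)
    (by linarith) ν hf
  rw [eLpNorm'_eq_lintegral_enorm, eLpNorm'_eq_lintegral_enorm] at h1
  have h2 := ENNReal.rpow_le_rpow (h1.trans (ENNReal.rpow_le_rpow h (by positivity)))
    (z := 2) (by norm_num)
  have hp0 : p ≠ 0 := by linarith
  rw [← ENNReal.rpow_mul, ← ENNReal.rpow_mul] at h2
  have e1 : (1 / 2 * 2 : ℝ) = 1 := by norm_num
  have e2 : (1 / (2 * p) * 2 : ℝ) = 1 / p := by field_simp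
  rw [e1, e2, ENNReal.rpow_one, ENNReal.ofReal_rpow_of_nonneg (by positivity) (by positivity),
    Real.mul_rpow hC (by positivity), ← Real.rpow_mul hv, mul_one_div_cancel hp0,
    Real.rpow_one] at h2
  exact h2

theorem IsLyapunov.exists_lintegral_gradError_le {d : ℕ} {𝒰 : Type*} [MeasurableSpace 𝒰]
    {π : EuclideanSpace ℝ (Fin d) → ℝ}
    {G : EuclideanSpace ℝ (Fin d) → 𝒰 → EuclideanSpace ℝ (Fin d)} {ν : Measure 𝒰}
    [IsProbabilityMeasure ν] (hG : IsUnbiasedEstimate π G ν)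
    {V : EuclideanSpace ℝ (Fin d) → ℝ} (hV : IsLyapunov π G ν V) :
    ∃ C, 0 ≤ C ∧ ∀ θ, ∫⁻ u, ‖gradError π G θ u‖ₑ ^ (2 : ℝ) ∂ν ≤
      ENNReal.ofReal (C * (1 + ‖θ‖ ^ 2)) := by
  obtain ⟨p, hp, C, hC, hm⟩ := hV.moment_error
  obtain ⟨C', hC', hs⟩ := hV.size
  obtain ⟨A, hA, hVA⟩ := exists_le_mul_one_add_norm_sq hV.one_le hV.differentiable (C := C')
    fun x ↦ by
      have h1 : ‖fderiv ℝ V x‖ = ‖gradient V x‖ := by simp [gradient]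
      rw [h1]
      linarith [hs x, sq_nonneg ‖gradLog π x‖]
  refine ⟨C ^ (1 / p) * A, by positivity, fun θ ↦ ?_⟩
  have hf : AEStronglyMeasurable (gradError π G θ) ν :=
    (hG.integrable θ).1.sub aestronglyMeasurable_const
  refine (lintegral_enorm_sq_le hf hp hC.le (by linarith [hV.one_le θ]) (hm θ)).trans ?_
  rw [mul_assoc]
  gcongr
  exact hVA θ

/-! ### Independence of the fresh auxiliary variable from the past -/

section Independence

variable {Ω : Type*} [mΩ : MeasurableSpace Ω] {P : Measure Ω} [IsProbabilityMeasure P]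

/-- Associativity of the product of the three laws. -/
theorem indepFun_prodMk_of_prodMk {α β γ : Type*} [MeasurableSpace α] [MeasurableSpace β]
    [MeasurableSpace γ] {X : Ω → α} {Y : Ω → β} {Z : Ω → γ} (hX : Measurable X)
    (hY : Measurable Y) (hZ : Measurable Z) (hXY : IndepFun X Y P)
    (hXYZ : IndepFun (fun ω ↦ (X ω, Y ω)) Z P) : IndepFun X (fun ω ↦ (Y ω, Z ω)) P := by
  have := Measure.isProbabilityMeasure_map (μ := P) hX.aemeasurable
  have := Measure.isProbabilityMeasure_map (μ := P) hY.aemeasurable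
  have := Measure.isProbabilityMeasure_map (μ := P) hZ.aemeasurable
  have hYZ : IndepFun Y Z P := hXYZ.comp measurable_snd measurable_id
  rw [indepFun_iff_map_prod_eq_prod_map_map hX.aemeasurable (hY.prodMk hZ).aemeasurable,
    (indepFun_iff_map_prod_eq_prod_map_map hY.aemeasurable hZ.aemeasurable).1 hYZ,
    ← Measure.prodAssoc_prod,
    ← (indepFun_iff_map_prod_eq_prod_map_map hX.aemeasurable hY.aemeasurable).1 hXY,
    ← (indepFun_iff_map_prod_eq_prod_map_map (hX.prodMk hY).aemeasurable hZ.aemeasurable).1 hXYZ,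
    Measure.map_map (by fun_prop) ((hX.prodMk hY).prodMk hZ)]
  rfl

/-- The σ-algebras generated by `Z` and the first `k` variables `U`. -/
def pastFiltration {α 𝒰 : Type*} [MeasurableSpace α] [MeasurableSpace 𝒰] {Z : Ω → α}
    (hZ : Measurable Z) {U : ℕ → Ω → 𝒰} (hU : ∀ k, Measurable (U k)) : Filtration ℕ mΩ where
  seq k := MeasurableSpace.comap (fun ω ↦ (fun j : Finset.range k ↦ U j ω, Z ω)) inferInstance
  mono' i j hij := by
    let g : (Finset.range j → 𝒰) × α → (Finset.range i → 𝒰) × α := fun y ↦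
      (fun l ↦ y.1 ⟨l, Finset.range_mono hij l.2⟩, y.2)
    have hg : Measurable g := by fun_prop
    change MeasurableSpace.comap (g ∘ fun ω ↦ (fun l : Finset.range j ↦ U l ω, Z ω)) _ ≤ _
    rw [← MeasurableSpace.comap_comp]
    exact MeasurableSpace.comap_mono hg.comap_le
  le' k := Measurable.comap_le (by fun_prop)

variable {α 𝒰 : Type*} [MeasurableSpace α] [MeasurableSpace 𝒰] {Z : Ω → α}
  (hZ : Measurable Z) {U : ℕ → Ω → 𝒰} (hU : ∀ k, Measurable (U k))

theorem measurable_pastFiltration_base (k : ℕ) : Measurable[pastFiltration hZ hU k] Z :=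
  measurable_snd.comp (comap_measurable _)

theorem measurable_pastFiltration_succ (k : ℕ) :
    Measurable[pastFiltration hZ hU (k + 1)] (U k) := by
  have h : Measurable fun y : (Finset.range (k + 1) → 𝒰) × α ↦
    y.1 ⟨k, Finset.self_mem_range_succ k⟩ := by fun_prop
  exact h.comp (comap_measurable fun ω ↦ (fun j : Finset.range (k + 1) ↦ U j ω, Z ω))

/-- Revealing all of `Z` (later the whole Brownian motion) at time `0` costs nothing, because `U` is
independent of it. With indices from zero, stage `k` knows `U j` for `j < k`, so `U k` is the fresh
variable. -/
theorem indepFun_of_measurable_pastFiltration (hind : iIndepFun U P)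
    (hUZ : IndepFun (fun ω k ↦ U k ω) Z P) (k : ℕ) {β : Type*} [MeasurableSpace β] {Y : Ω → β}
    (hY : Measurable[pastFiltration hZ hU k] Y) : IndepFun Y (U k) P := by
  have h1 : IndepFun (U k) (fun ω (j : Finset.range k) ↦ U j ω) P :=
    (hind.indepFun_finset {k} (Finset.range k) (by simp) hU).comp
      (φ := fun y : ({k} : Finset ℕ) → 𝒰 ↦ y ⟨k, Finset.mem_singleton_self k⟩) (by fun_prop)
      measurable_id
  have h2 : IndepFun (fun ω ↦ (U k ω, fun j : Finset.range k ↦ U j ω)) Z P :=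
    hUZ.comp (φ := fun y ↦ (y k, fun j : Finset.range k ↦ y j)) (by fun_prop) measurable_id
  have h3 := (indepFun_prodMk_of_prodMk (hU k) (by fun_prop) hZ h1 h2).symm
  exact indep_of_indep_of_le_left h3 hY.comap_le

end Independence

theorem memLp_two_of_lintegral_le {Ω E : Type*} [MeasurableSpace Ω] {P : Measure Ω}
    [NormedAddCommGroup E] {f : Ω → E} (hf : AEStronglyMeasurable f P) {B : ℝ}
    (h : ∫⁻ ω, ‖f ω‖ₑ ^ (2 : ℝ) ∂P ≤ ENNReal.ofReal B) (hB : 0 ≤ B) :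
    MemLp f 2 P ∧ ∫ ω, ‖f ω‖ ^ 2 ∂P ≤ B := by
  have hm : MemLp f 2 P := ⟨hf, by
    rw [eLpNorm_lt_top_iff_lintegral_rpow_enorm_lt_top (by simp) (by simp)]
    simpa using h.trans_lt ENNReal.ofReal_lt_top⟩
  refine ⟨hm, ?_⟩
  rw [← ENNReal.ofReal_le_ofReal_iff hB, ofReal_integral_eq_lintegral_ofReal
    (hm.integrable_norm_pow two_ne_zero) (ae_of_all _ fun ω ↦ by positivity)]
  refine le_trans (le_of_eq (lintegral_congr fun ω ↦ ?_)) h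
  rw [ENNReal.ofReal_pow (norm_nonneg _), ofReal_norm]
  norm_cast

/-! ### Moments and orthogonality of one increment -/

section MartingaleIncrement

variable {Ω : Type*} [mΩ : MeasurableSpace Ω] {P : Measure Ω} [IsProbabilityMeasure P]
  {𝒰 : Type*} [MeasurableSpace 𝒰] {ν : Measure 𝒰} [IsProbabilityMeasure ν]
  {E : Type*} [NormedAddCommGroup E] [SecondCountableTopology E] [MeasurableSpace E] [BorelSpace E]
  {H : E → 𝒰 → E} {C : ℝ} {θ : Ω → E} {U : Ω → 𝒰}

/-- By independence the joint law is a product, so Tonelli allows integrating over `u` first with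
`θ` frozen. -/
theorem lintegral_enorm_sq_comp_le (hH : Measurable (Function.uncurry H)) (hC : 0 ≤ C)
    (hHC : ∀ x, ∫⁻ u, ‖H x u‖ₑ ^ (2 : ℝ) ∂ν ≤ ENNReal.ofReal (C * (1 + ‖x‖ ^ 2)))
    (hθ : Measurable θ) (hθ2 : MemLp θ 2 P) (hU : Measurable U) (hlaw : P.map U = ν)
    (hind : IndepFun θ U P) : ∫⁻ ω, ‖H (θ ω) (U ω)‖ₑ ^ (2 : ℝ) ∂P ≤
      ENNReal.ofReal (C * (1 + ∫ ω, ‖θ ω‖ ^ 2 ∂P)) := by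
  have h1 : ∫⁻ ω, ‖H (θ ω) (U ω)‖ₑ ^ (2 : ℝ) ∂P =
      ∫⁻ y, ‖H y.1 y.2‖ₑ ^ (2 : ℝ) ∂(P.map fun ω ↦ (θ ω, U ω)) := by
    rw [lintegral_map (f := fun y : E × 𝒰 ↦ ‖H y.1 y.2‖ₑ ^ (2 : ℝ))
      (by have : Measurable fun y : E × 𝒰 ↦ H y.1 y.2 := hH
          fun_prop) (hθ.prodMk hU)]
  have : IsProbabilityMeasure (P.map θ) := Measure.isProbabilityMeasure_map hθ.aemeasurable
  rw [h1, (indepFun_iff_map_prod_eq_prod_map_map hθ.aemeasurable hU.aemeasurable).1 hind, hlaw,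
    lintegral_prod _ (by
      have : Measurable fun y : E × 𝒰 ↦ H y.1 y.2 := hH
      fun_prop)]
  refine (lintegral_mono hHC).trans ?_
  have hi : Integrable (fun ω ↦ C * (1 + ‖θ ω‖ ^ 2)) P :=
    ((integrable_const _).add (hθ2.integrable_norm_pow two_ne_zero)).const_mul _
  rw [lintegral_map (by fun_prop) hθ, ← ofReal_integral_eq_lintegral_ofReal hi
    (ae_of_all _ fun ω ↦ by positivity), integral_const_mul, integral_add (integrable_const _)
    (hθ2.integrable_norm_pow two_ne_zero)]
  simp

variable [InnerProductSpace ℝ E] [CompleteSpace E]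

/-- The martingale property in integrated form, avoiding conditional expectations: with `(Y, θ)`
frozen, the integral over `u` is the inner product of `Y` with the mean of `H θ`, which is zero. -/
theorem integral_inner_comp_eq_zero (hH : Measurable (Function.uncurry H))
    (hHi : ∀ x, Integrable (H x) ν) (hH0 : ∀ x, ∫ u, H x u ∂ν = 0)
    (hθ : Measurable θ) (hU : Measurable U) (hlaw : P.map U = ν)
    {Y : Ω → E} (hY : Measurable Y) (hY2 : MemLp Y 2 P) (hH2 : MemLp (fun ω ↦ H (θ ω) (U ω)) 2 P)
    (hind : IndepFun (fun ω ↦ (Y ω, θ ω)) U P) : ∫ ω, inner ℝ (Y ω) (H (θ ω) (U ω)) ∂P = 0 := by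
  have hH' : Measurable fun y : (E × E) × 𝒰 ↦ H y.1.2 y.2 :=
    hH.comp ((measurable_snd.comp measurable_fst).prodMk measurable_snd)
  have hm : Measurable fun y : (E × E) × 𝒰 ↦ inner ℝ y.1.1 (H y.1.2 y.2) := by fun_prop
  have hYθ : Measurable fun ω ↦ (Y ω, θ ω) := hY.prodMk hθ
  have hint : Integrable (fun ω ↦ inner ℝ (Y ω) (H (θ ω) (U ω))) P := by
    refine (hY2.norm.integrable_mul hH2.norm).mono'
      (hY2.1.inner hH2.1) (ae_of_all _ fun ω ↦ ?_)
    exact norm_inner_le_norm _ _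
  have : IsProbabilityMeasure (P.map fun ω ↦ (Y ω, θ ω)) :=
    Measure.isProbabilityMeasure_map hYθ.aemeasurable
  have hmap := (indepFun_iff_map_prod_eq_prod_map_map hYθ.aemeasurable hU.aemeasurable).1 hind
  rw [hlaw] at hmap
  have h1 : ∫ ω, inner ℝ (Y ω) (H (θ ω) (U ω)) ∂P =
      ∫ y, inner ℝ y.1.1 (H y.1.2 y.2) ∂(P.map fun ω ↦ ((Y ω, θ ω), U ω)) := by
    rw [integral_map (hYθ.prodMk hU).aemeasurable hm.aestronglyMeasurable]
  have hint' : Integrable (fun y : (E × E) × 𝒰 ↦ inner ℝ y.1.1 (H y.1.2 y.2))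
      (P.map fun ω ↦ ((Y ω, θ ω), U ω)) :=
    (integrable_map_measure hm.aestronglyMeasurable (hYθ.prodMk hU).aemeasurable).2 hint
  rw [hmap] at h1 hint'
  rw [h1, integral_prod _ hint']
  refine integral_eq_zero_of_ae (ae_of_all _ fun y ↦ ?_)
  simp only [Pi.zero_apply]
  rw [integral_inner (hHi y.2), hH0, inner_zero_right]

end MartingaleIncrement

/-- Discrete Grönwall inequality up to a final index. -/
theorem le_mul_exp_of_succ_le {u c b : ℕ → ℝ} {m : ℕ} (hu : 0 ≤ u 0)
    (hc : ∀ k < m, 0 ≤ c k) (hb : ∀ k < m, 0 ≤ b k)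
    (h : ∀ k < m, u (k + 1) ≤ (1 + c k) * u k + b k) (k : ℕ) (hk : k ≤ m) :
    u k ≤ (u 0 + ∑ j ∈ Finset.range k, b j) * Real.exp (∑ j ∈ Finset.range k, c j) := by
  induction k with
  | zero => simp
  | succ k ih =>
    have hk' : k < m := hk
    have ih := ih hk'.le
    rw [Finset.sum_range_succ, Finset.sum_range_succ, Real.exp_add]
    have hB : 0 ≤ ∑ j ∈ Finset.range k, b j :=
      Finset.sum_nonneg fun j hj ↦ hb j ((Finset.mem_range.1 hj).trans hk')
    have hS : 0 ≤ ∑ j ∈ Finset.range k, c j :=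
      Finset.sum_nonneg fun j hj ↦ hc j ((Finset.mem_range.1 hj).trans hk')
    set B := ∑ j ∈ Finset.range k, b j
    set e := Real.exp (∑ j ∈ Finset.range k, c j)
    have he : 1 ≤ e := Real.one_le_exp hS
    have hck := hc k hk'
    have hbk := hb k hk'
    have h1 : 1 + c k ≤ Real.exp (c k) := by linarith [Real.add_one_le_exp (c k)]
    have h2 : 1 ≤ e * Real.exp (c k) := one_le_mul_of_one_le_of_one_le he (by linarith)
    calc u (k + 1) ≤ (1 + c k) * u k + b k := h k hk'
      _ ≤ Real.exp (c k) * ((u 0 + B) * e) + b k * (e * Real.exp (c k)) := by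
        refine add_le_add ?_ (le_mul_of_one_le_right hbk h2)
        exact (mul_le_mul_of_nonneg_left ih (by linarith)).trans
          (mul_le_mul_of_nonneg_right h1 (by positivity))
      _ = _ := by ring

/-! ### The squared martingale and its maximum -/

section MartingaleSum

variable {Ω : Type*} [mΩ : MeasurableSpace Ω] {P : Measure Ω} [IsProbabilityMeasure P]
  {𝒰 : Type*} [MeasurableSpace 𝒰] {ν : Measure 𝒰} [IsProbabilityMeasure ν]
  {E : Type*} [NormedAddCommGroup E] [SecondCountableTopology E] [MeasurableSpace E] [BorelSpace E]
  [InnerProductSpace ℝ E] [CompleteSpace E]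
  {H : E → 𝒰 → E} {θ M : ℕ → Ω → E} {U : ℕ → Ω → 𝒰} {a : ℕ → ℝ} {𝓕 : Filtration ℕ mΩ}

theorem integral_norm_add_smul_sq {H : E → 𝒰 → E} {θ Y : Ω → E} {U : Ω → 𝒰} (a : ℝ)
    (hH : Measurable (Function.uncurry H))
    (hHi : ∀ x, Integrable (H x) ν) (hH0 : ∀ x, ∫ u, H x u ∂ν = 0)
    (hθ : Measurable θ) (hU : Measurable U) (hlaw : P.map U = ν)
    (hY : Measurable Y) (hY2 : MemLp Y 2 P) (hH2 : MemLp (fun ω ↦ H (θ ω) (U ω)) 2 P)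
    (hind : IndepFun (fun ω ↦ (Y ω, θ ω)) U P) :
    ∫ ω, ‖Y ω + a • H (θ ω) (U ω)‖ ^ 2 ∂P =
      ∫ ω, ‖Y ω‖ ^ 2 ∂P + a ^ 2 * ∫ ω, ‖H (θ ω) (U ω)‖ ^ 2 ∂P := by
  have h0 := integral_inner_comp_eq_zero hH hHi hH0 hθ hU hlaw hY hY2 hH2 hind
  have hi : Integrable (fun ω ↦ inner ℝ (Y ω) (H (θ ω) (U ω))) P :=
    (hY2.norm.integrable_mul hH2.norm).mono' (hY2.1.inner hH2.1)
      (ae_of_all _ fun ω ↦ norm_inner_le_norm _ _)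
  have h1 : ∀ ω, ‖Y ω + a • H (θ ω) (U ω)‖ ^ 2 = ‖Y ω‖ ^ 2 +
      (2 * a * inner ℝ (Y ω) (H (θ ω) (U ω)) + a ^ 2 * ‖H (θ ω) (U ω)‖ ^ 2) := fun ω ↦ by
    rw [norm_add_sq_real, inner_smul_right, norm_smul, mul_pow, Real.norm_eq_abs, sq_abs]
    ring
  have hY' := hY2.integrable_norm_pow two_ne_zero
  have hH' := hH2.integrable_norm_pow two_ne_zero
  have hs : Integrable (fun ω ↦ 2 * a * inner ℝ (Y ω) (H (θ ω) (U ω)) +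
      a ^ 2 * ‖H (θ ω) (U ω)‖ ^ 2) P := (hi.const_mul _).add (hH'.const_mul _)
  simp_rw [h1]
  rw [integral_add hY' hs, integral_add (hi.const_mul _) (hH'.const_mul _), integral_const_mul, integral_const_mul, h0]
  ring

/-- Orthogonality is tested against the indicator of a past event `s` times `M k`. The cross term
then vanishes on `s`, and the remaining square is nonnegative. -/
theorem submartingale_norm_sq (hH : Measurable (Function.uncurry H))
    (hHi : ∀ x, Integrable (H x) ν) (hH0 : ∀ x, ∫ u, H x u ∂ν = 0)
    (hθ : ∀ k, Measurable[𝓕 k] (θ k)) (hU : ∀ k, Measurable (U k)) (hlaw : ∀ k, P.map (U k) = ν)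
    (hM : ∀ k, Measurable[𝓕 k] (M k)) (hM2 : ∀ k, MemLp (M k) 2 P)
    (hH2 : ∀ k, MemLp (fun ω ↦ H (θ k ω) (U k ω)) 2 P)
    (hind : ∀ k (Y : Ω → E × E), Measurable[𝓕 k] Y → IndepFun Y (U k) P)
    (hsucc : ∀ k ω, M (k + 1) ω = M k ω + a k • H (θ k ω) (U k ω)) :
    Submartingale (fun k ω ↦ ‖M k ω‖ ^ 2) 𝓕 P := by
  have hi : ∀ k, Integrable (fun ω ↦ ‖M k ω‖ ^ 2) P := fun k ↦
    (hM2 k).integrable_norm_pow two_ne_zero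
  refine submartingale_of_setIntegral_le_succ (fun k ↦ ?_) hi fun k s hs ↦ ?_
  · exact (Measurable.stronglyMeasurable (hM k)).norm.pow 2
  · have hs' : MeasurableSet s := 𝓕.le k s hs
    have h0 := integral_inner_comp_eq_zero (Y := s.indicator (M k)) hH hHi hH0
      ((hθ k).mono (𝓕.le k) le_rfl) (hU k)
      (hlaw k) (((hM k).mono (𝓕.le k) le_rfl).indicator hs') ((hM2 k).indicator hs') (hH2 k)
      (hind k _ (Measurable.prodMk (Measurable.indicator (hM k) hs) (hθ k)))
    have h1 : (fun ω ↦ inner ℝ (s.indicator (M k) ω) (H (θ k ω) (U k ω))) =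
        s.indicator fun ω ↦ inner ℝ (M k ω) (H (θ k ω) (U k ω)) := by
      ext ω
      by_cases h : ω ∈ s <;> simp [h]
    rw [h1, integral_indicator hs'] at h0
    have hin : Integrable (fun ω ↦ inner ℝ (M k ω) (H (θ k ω) (U k ω))) P :=
      ((hM2 k).norm.integrable_mul (hH2 k).norm).mono' ((hM2 k).1.inner (hH2 k).1)
        (ae_of_all _ fun ω ↦ norm_inner_le_norm _ _)
    have h2 : ∫ ω in s, (‖M k ω‖ ^ 2 + 2 * a k * inner ℝ (M k ω) (H (θ k ω) (U k ω))) ∂P =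
        ∫ ω in s, ‖M k ω‖ ^ 2 ∂P := by
      rw [integral_add (hi k).integrableOn (hin.const_mul _).integrableOn, integral_const_mul, h0]
      ring
    rw [← h2]
    refine integral_mono ((hi k).integrableOn.add (hin.const_mul _).integrableOn)
      (hi (k + 1)).integrableOn fun ω ↦ ?_
    simp only [hsucc, norm_add_sq_real, inner_smul_right]
    nlinarith [sq_nonneg ‖a k • H (θ k ω) (U k ω)‖]

end MartingaleSum

/-- Doob's maximal inequality for the norm of a process whose squared norm is a submartingale. -/
theorem measure_exists_le_norm_le {Ω E : Type*} [mΩ : MeasurableSpace Ω] {P : Measure Ω}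
    [IsProbabilityMeasure P] [NormedAddCommGroup E] {M : ℕ → Ω → E} {𝓕 : Filtration ℕ mΩ}
    (hsub : Submartingale (fun k ω ↦ ‖M k ω‖ ^ 2) 𝓕 P)
    (m : ℕ) {ε : ℝ} (hε : 0 < ε) :
    P {ω | ∃ k ≤ m, ε ≤ ‖M k ω‖} ≤ ENNReal.ofReal ((∫ ω, ‖M m ω‖ ^ 2 ∂P) / ε ^ 2) := by
  have h := maximal_ineq hsub (fun k ω ↦ sq_nonneg ‖M k ω‖) (ε := (ε ^ 2).toNNReal) m
  rw [Real.coe_toNNReal _ (sq_nonneg ε)] at h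
  have hset : {ω | ε ^ 2 ≤ (Finset.range (m + 1)).sup'
      Finset.nonempty_range_add_one fun k ↦ ‖M k ω‖ ^ 2} = {ω | ∃ k ≤ m, ε ≤ ‖M k ω‖} := by
    ext ω
    simp only [Set.mem_ofPred_eq, Finset.le_sup'_iff, Finset.mem_range, Nat.lt_succ_iff]
    refine exists_congr fun k ↦ and_congr_right fun _ ↦ ?_
    exact pow_le_pow_iff_left₀ hε.le (norm_nonneg _) two_ne_zero
  rw [hset] at h
  have h2 := h.trans (ENNReal.ofReal_le_ofReal (setIntegral_le_integral (hsub.integrable m)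
    (ae_of_all _ fun ω ↦ sq_nonneg ‖M m ω‖)))
  have hne : ENNReal.ofReal (ε ^ 2) ≠ 0 := by simpa using hε.ne'
  rw [ENNReal.ofReal_div_of_pos (by positivity), ENNReal.le_div_iff_mul_le (.inl hne)
    (.inl ENNReal.ofReal_ne_top), mul_comm]
  exact h2

/-! ### The chain as a random process -/

section Chain

variable {d : ℕ} {𝒰 Ω : Type*} {π : EuclideanSpace ℝ (Fin d) → ℝ}
  {G : EuclideanSpace ℝ (Fin d) → 𝒰 → EuclideanSpace ℝ (Fin d)}

/-- The SGLD chain as a random process. -/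
noncomputable def sgld (G : EuclideanSpace ℝ (Fin d) → 𝒰 → EuclideanSpace ℝ (Fin d))
    (θ₀ : EuclideanSpace ℝ (Fin d)) (δ : ℕ → ℝ) (U : ℕ → Ω → 𝒰)
    (W : ℝ≥0 → Ω → EuclideanSpace ℝ (Fin d)) (k : ℕ) (ω : Ω) : EuclideanSpace ℝ (Fin d) :=
  chain G θ₀ δ (fun j ↦ U j ω) (noise (fun t ↦ W t ω) δ) k

/-- The accumulated error of the stochastic gradients along the SGLD chain. -/
noncomputable def errorSum (π : EuclideanSpace ℝ (Fin d) → ℝ)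
    (G : EuclideanSpace ℝ (Fin d) → 𝒰 → EuclideanSpace ℝ (Fin d))
    (θ₀ : EuclideanSpace ℝ (Fin d)) (δ : ℕ → ℝ) (U : ℕ → Ω → 𝒰)
    (W : ℝ≥0 → Ω → EuclideanSpace ℝ (Fin d)) (k : ℕ) (ω : Ω) : EuclideanSpace ℝ (Fin d) :=
  ∑ j ∈ Finset.range k, (1 / 2 * δ j) • gradError π G (sgld G θ₀ δ U W j ω) (U j ω)

variable {θ₀ : EuclideanSpace ℝ (Fin d)} {δ : ℕ → ℝ} {U : ℕ → Ω → 𝒰}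
  {W : ℝ≥0 → Ω → EuclideanSpace ℝ (Fin d)}

theorem sqrt_smul_noise (w : ℝ≥0 → EuclideanSpace ℝ (Fin d)) {δ : ℕ → ℝ} {k : ℕ} (hk : 0 < δ k) :
    √(δ k) • noise w δ k = w (time δ (k + 1)).toNNReal - w (time δ k).toNNReal := by
  rw [noise, smul_smul, mul_inv_cancel₀ (Real.sqrt_pos.2 hk).ne', one_smul]

theorem sgld_succ (k : ℕ) (ω : Ω) : sgld G θ₀ δ U W (k + 1) ω = sgld G θ₀ δ U W k ω +
    δ k • drift π (sgld G θ₀ δ U W k ω) +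
    (1 / 2 * δ k) • gradError π G (sgld G θ₀ δ U W k ω) (U k ω) +
    √(δ k) • noise (fun t ↦ W t ω) δ k := by
  rw [sgld, chain, ← sgld, gradError, drift]
  module

theorem errorSum_succ (k : ℕ) (ω : Ω) : errorSum π G θ₀ δ U W (k + 1) ω =
    errorSum π G θ₀ δ U W k ω +
      (1 / 2 * δ k) • gradError π G (sgld G θ₀ δ U W k ω) (U k ω) :=
  Finset.sum_range_succ _ _

variable [MeasurableSpace 𝒰] [MeasurableSpace Ω]

/-- Only `U j` with `j < k` is required and the σ-algebra on `Ω` is arbitrary, so the same lemma,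
read with the `k`-th σ-algebra of the filtration, yields adaptedness. -/
theorem measurable_sgld (hG : Measurable (Function.uncurry G)) (hW : ∀ t, Measurable (W t))
    (k : ℕ) (hU : ∀ j < k, Measurable (U j)) : Measurable (sgld G θ₀ δ U W k) := by
  induction k with
  | zero => exact measurable_const
  | succ k ih =>
    have h1 := ih fun j hj ↦ hU j (by omega)
    have h2 : Measurable fun ω ↦ G (sgld G θ₀ δ U W k ω) (U k ω) :=
      hG.comp (h1.prodMk (hU k (by omega)))
    have h3 : Measurable fun ω ↦ noise (fun t ↦ W t ω) δ k :=
      ((hW (time δ (k + 1)).toNNReal).sub (hW (time δ k).toNNReal)).const_smul (√(δ k))⁻¹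
    have h4 : Measurable fun ω ↦ (1 / 2 * δ k) • G (sgld G θ₀ δ U W k ω) (U k ω) :=
      h2.const_smul (1 / 2 * δ k)
    have h5 : Measurable fun ω ↦ √(δ k) • noise (fun t ↦ W t ω) δ k := h3.const_smul √(δ k)
    exact (h1.add h4).add h5

theorem measurable_gradError (hG : Measurable (Function.uncurry G))
    (hb : Measurable (gradLog π)) : Measurable (Function.uncurry (gradError π G)) :=
  hG.sub (hb.comp measurable_fst)

theorem measurable_errorSum (hG : Measurable (Function.uncurry G))
    (hb : Measurable (gradLog π)) (hW : ∀ t, Measurable (W t))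
    (k : ℕ) (hU : ∀ j < k, Measurable (U j)) : Measurable (errorSum π G θ₀ δ U W k) := by
  refine Finset.measurable_fun_sum _ fun j hj ↦ ?_
  have hj := Finset.mem_range.1 hj
  have h : Measurable fun ω ↦ gradError π G (sgld G θ₀ δ U W j ω) (U j ω) :=
    (measurable_gradError hG hb).comp
      ((measurable_sgld hG hW j fun i hi ↦ hU i (hi.trans hj)).prodMk (hU j hj))
  exact h.const_smul (1 / 2 * δ j)

end Chain

theorem exists_norm_sq_le_of_lipschitz {E F : Type*} [NormedAddCommGroup E] [NormedAddCommGroup F]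
    {b : E → F} {K : ℝ≥0} (hb : LipschitzWith K b) :
    ∃ B, 0 ≤ B ∧ ∀ x, ‖b x‖ ^ 2 ≤ B * (1 + ‖x‖ ^ 2) := by
  refine ⟨2 * ‖b 0‖ ^ 2 + 2 * K ^ 2, by positivity, fun x ↦ ?_⟩
  have h1 : ‖b x‖ ≤ ‖b 0‖ + K * ‖x‖ := by
    have h2 := hb.norm_sub_le x 0
    rw [sub_zero] at h2
    have h3 := norm_sub_norm_le (b x) (b 0)
    linarith
  have h4 := pow_le_pow_left₀ (norm_nonneg _) h1 2
  have h5 := sq_nonneg (‖b 0‖ - K * ‖x‖)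
  have h6 : 0 ≤ ‖b 0‖ ^ 2 * ‖x‖ ^ 2 := by positivity
  nlinarith [sq_nonneg (K : ℝ)]

theorem memLp_two_comp_lipschitz {Ω E : Type*} [MeasurableSpace Ω] {P : Measure Ω}
    [IsFiniteMeasure P] [NormedAddCommGroup E] {b : E → E} {K : ℝ≥0} (hb : LipschitzWith K b)
    {θ : Ω → E} (hθ : MemLp θ 2 P) : MemLp (fun ω ↦ b (θ ω)) 2 P := by
  have h : MemLp (fun ω ↦ ‖b 0‖ + K * ‖θ ω‖) 2 P := 
    (memLp_const ‖b 0‖).add (hθ.norm.const_mul (K : ℝ))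
  refine h.mono (hb.continuous.comp_aestronglyMeasurable hθ.1) (ae_of_all _ fun ω ↦ ?_)
  rw [Real.norm_of_nonneg (by positivity)]
  have h2 := hb.norm_sub_le (θ ω) 0
  rw [sub_zero] at h2
  have h3 := norm_sub_norm_le (b (θ ω)) (b 0)
  linarith

/-- Young's inequality on the cross term, weighted so that the excess over `‖x‖²` is of order `a`,
as a Grönwall recursion needs. -/
theorem norm_add_smul_sq_le {E : Type*} [NormedAddCommGroup E] [InnerProductSpace ℝ E] (x y : E)
    {a : ℝ} (ha : 0 ≤ a) :
    ‖x + a • y‖ ^ 2 ≤ (1 + a) * ‖x‖ ^ 2 + (a + a ^ 2) * ‖y‖ ^ 2 := by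
  rw [norm_add_sq_real, inner_smul_right, norm_smul, mul_pow, Real.norm_of_nonneg ha]
  have h1 := real_inner_le_norm x y
  nlinarith [mul_nonneg ha (sq_nonneg (‖x‖ - ‖y‖)), mul_le_mul_of_nonneg_left h1 ha]

/-- The auxiliary variables `U` are independent with law `ν`, and independent of the Brownian
motion `W`. -/
structure IsDrivingNoise {d : ℕ} {𝒰 Ω : Type*} [MeasurableSpace 𝒰] [MeasurableSpace Ω]
    (U : ℕ → Ω → 𝒰) (W : ℝ≥0 → Ω → EuclideanSpace ℝ (Fin d)) (ν : Measure 𝒰) (P : Measure Ω) :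
    Prop where
  brownian : IsStandardBM W P
  measurable : ∀ k, Measurable (U k)
  law : ∀ k, P.map (U k) = ν
  indep : iIndepFun U P
  indep_brownian : IndepFun (fun ω k ↦ U k ω) (fun ω t ↦ W t ω) P

/-! ### Uniform second moments and smallness of the accumulated error -/

section Moments

variable {d : ℕ} {𝒰 : Type*} [MeasurableSpace 𝒰] {Ω : Type*} [MeasurableSpace Ω]
  {π : EuclideanSpace ℝ (Fin d) → ℝ} {ν : Measure 𝒰}
  {G : EuclideanSpace ℝ (Fin d) → 𝒰 → EuclideanSpace ℝ (Fin d)} {P : Measure Ω}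
  {θ₀ : EuclideanSpace ℝ (Fin d)} {δ : ℕ → ℝ} {U : ℕ → Ω → 𝒰}
  {W : ℝ≥0 → Ω → EuclideanSpace ℝ (Fin d)} {K : ℝ≥0} {C : ℝ}

theorem continuous_gradLog (hb : LipschitzWith K (drift π)) : Continuous (gradLog π) := by
  have h : gradLog π = fun x ↦ (2 : ℝ) • drift π x := by
    ext1 x
    rw [drift, smul_smul]
    norm_num
  rw [h]
  exact hb.continuous.const_smul (2 : ℝ)

theorem IsDrivingNoise.measurable_brownian (hN : IsDrivingNoise U W ν P) :
    Measurable fun ω t ↦ W t ω :=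
  measurable_pi_lambda _ hN.brownian.measurable

/-- The history of the SGLD chain, together with the whole Brownian motion. -/
noncomputable def IsDrivingNoise.filtration (hN : IsDrivingNoise U W ν P) :
    Filtration ℕ ‹MeasurableSpace Ω› :=
  pastFiltration hN.measurable_brownian hN.measurable

theorem IsDrivingNoise.measurable_brownian_filtration (hN : IsDrivingNoise U W ν P) (k : ℕ)
    (t : ℝ≥0) : Measurable[hN.filtration k] (W t) :=
  (measurable_pi_apply t).comp (measurable_pastFiltration_base hN.measurable_brownian
    hN.measurable k)

theorem IsDrivingNoise.measurable_filtration (hN : IsDrivingNoise U W ν P) {j k : ℕ}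
    (hjk : j < k) : Measurable[hN.filtration k] (U j) :=
  (measurable_pastFiltration_succ hN.measurable_brownian hN.measurable j).mono
    (hN.filtration.mono hjk) le_rfl

theorem IsDrivingNoise.measurable_sgld (hN : IsDrivingNoise U W ν P)
    (hG : Measurable (Function.uncurry G)) (k : ℕ) :
    Measurable[hN.filtration k] (sgld G θ₀ δ U W k) :=
  @SGLD.measurable_sgld d 𝒰 Ω G θ₀ δ U W _ (hN.filtration k) hG
    (hN.measurable_brownian_filtration k) k fun _ hj ↦ hN.measurable_filtration hj

theorem IsDrivingNoise.measurable_errorSum (hN : IsDrivingNoise U W ν P)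
    (hG : Measurable (Function.uncurry G)) (hb : Measurable (gradLog π)) (k : ℕ) :
    Measurable[hN.filtration k] (errorSum π G θ₀ δ U W k) :=
  @SGLD.measurable_errorSum d 𝒰 Ω π G θ₀ δ U W _ (hN.filtration k) hG hb
    (hN.measurable_brownian_filtration k) k fun _ hj ↦ hN.measurable_filtration hj

variable [IsProbabilityMeasure P]

theorem IsDrivingNoise.indepFun (hN : IsDrivingNoise U W ν P) (k : ℕ) {β : Type*}
    [MeasurableSpace β] {Y : Ω → β} (hY : Measurable[hN.filtration k] Y) : IndepFun Y (U k) P :=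
  indepFun_of_measurable_pastFiltration hN.measurable_brownian hN.measurable hN.indep
    hN.indep_brownian k hY

variable [IsProbabilityMeasure ν]

theorem IsUnbiasedEstimate.integrable_gradError (hG : IsUnbiasedEstimate π G ν)
    (x : EuclideanSpace ℝ (Fin d)) : Integrable (gradError π G x) ν :=
  (hG.integrable x).sub (integrable_const _)

theorem IsUnbiasedEstimate.integral_gradError (hG : IsUnbiasedEstimate π G ν)
    (x : EuclideanSpace ℝ (Fin d)) : ∫ u, gradError π G x u ∂ν = 0 := by
  have h := integral_sub (hG.integrable x) (integrable_const (μ := ν) (gradLog π x))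
  rw [hG.integral_eq, integral_const, probReal_univ, one_smul, sub_self] at h
  exact h

theorem IsDrivingNoise.memLp_gradError (hN : IsDrivingNoise U W ν P)
    (hG : IsUnbiasedEstimate π G ν) (hb : LipschitzWith K (drift π)) (hC : 0 ≤ C)
    (hHC : ∀ x, ∫⁻ u, ‖gradError π G x u‖ₑ ^ (2 : ℝ) ∂ν ≤ ENNReal.ofReal (C * (1 + ‖x‖ ^ 2)))
    {k : ℕ} (hk : MemLp (sgld G θ₀ δ U W k) 2 P) :
    MemLp (fun ω ↦ gradError π G (sgld G θ₀ δ U W k ω) (U k ω)) 2 P ∧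
      ∫ ω, ‖gradError π G (sgld G θ₀ δ U W k ω) (U k ω)‖ ^ 2 ∂P ≤
        C * (1 + ∫ ω, ‖sgld G θ₀ δ U W k ω‖ ^ 2 ∂P) := by
  have hH := measurable_gradError hG.measurable (continuous_gradLog hb).measurable
  have hθ := hN.measurable_sgld (θ₀ := θ₀) (δ := δ) hG.measurable k
  have hθ' := hθ.mono (hN.filtration.le k) le_rfl
  have h0 : 0 ≤ ∫ ω, ‖sgld G θ₀ δ U W k ω‖ ^ 2 ∂P := integral_nonneg fun _ ↦ sq_nonneg _
  exact memLp_two_of_lintegral_le (hH.comp (hθ'.prodMk (hN.measurable k))).aestronglyMeasurable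
    (lintegral_enorm_sq_comp_le hH hC hHC hθ' hk (hN.measurable k) (hN.law k)
      (hN.indepFun k hθ)) (by positivity)

/-- Qualitative only: the integrability needed for the orthogonality arguments. The bound uniform in
the step-sizes is `exists_integral_sgld_sq_le`. -/
theorem IsDrivingNoise.memLp_sgld (hN : IsDrivingNoise U W ν P)
    (hG : IsUnbiasedEstimate π G ν) (hb : LipschitzWith K (drift π)) (hC : 0 ≤ C)
    (hHC : ∀ x, ∫⁻ u, ‖gradError π G x u‖ₑ ^ (2 : ℝ) ∂ν ≤ ENNReal.ofReal (C * (1 + ‖x‖ ^ 2)))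
    (k : ℕ) : MemLp (sgld G θ₀ δ U W k) 2 P := by
  induction k with
  | zero => exact memLp_const _
  | succ k ih =>
    have h1 := (hN.memLp_gradError hG hb hC hHC ih).1
    have h2 := memLp_two_comp_lipschitz hb ih
    have h3 : MemLp (fun ω ↦ noise (fun t ↦ W t ω) δ k) 2 P :=
      ((hN.brownian.memLp_two _).sub (hN.brownian.memLp_two _)).const_smul (√(δ k))⁻¹
    have h4 := ((ih.add (h2.const_smul (δ k))).add (h1.const_smul (1 / 2 * δ k))).add
      (h3.const_smul √(δ k))
    exact h4.ae_eq (ae_of_all _ fun ω ↦ (sgld_succ k ω).symm)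

theorem IsDrivingNoise.memLp_errorSum (hN : IsDrivingNoise U W ν P)
    (hG : IsUnbiasedEstimate π G ν) (hb : LipschitzWith K (drift π)) (hC : 0 ≤ C)
    (hHC : ∀ x, ∫⁻ u, ‖gradError π G x u‖ₑ ^ (2 : ℝ) ∂ν ≤ ENNReal.ofReal (C * (1 + ‖x‖ ^ 2)))
    (k : ℕ) : MemLp (errorSum π G θ₀ δ U W k) 2 P :=
  memLp_finsetSum _ fun j _ ↦ ((hN.memLp_gradError hG hb hC hHC
    (hN.memLp_sgld hG hb hC hHC j)).1).const_smul (1 / 2 * δ j)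

theorem IsDrivingNoise.submartingale_errorSum (hN : IsDrivingNoise U W ν P)
    (hG : IsUnbiasedEstimate π G ν) (hb : LipschitzWith K (drift π)) (hC : 0 ≤ C)
    (hHC : ∀ x, ∫⁻ u, ‖gradError π G x u‖ₑ ^ (2 : ℝ) ∂ν ≤ ENNReal.ofReal (C * (1 + ‖x‖ ^ 2))) :
    Submartingale (fun k ω ↦ ‖errorSum π G θ₀ δ U W k ω‖ ^ 2) hN.filtration P :=
  submartingale_norm_sq (θ := sgld G θ₀ δ U W) (a := fun k ↦ 1 / 2 * δ k)
    (measurable_gradError hG.measurable (continuous_gradLog hb).measurable)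
    hG.integrable_gradError hG.integral_gradError (hN.measurable_sgld hG.measurable)
    hN.measurable hN.law (hN.measurable_errorSum hG.measurable (continuous_gradLog hb).measurable)
    (hN.memLp_errorSum hG hb hC hHC)
    (fun k ↦ (hN.memLp_gradError hG hb hC hHC (hN.memLp_sgld hG hb hC hHC k)).1)
    (fun k _ hY ↦ hN.indepFun k hY) errorSum_succ

/-- Cross terms vanish, so the step-sizes enter squared: the source of the extra factor `mesh`. -/
theorem IsDrivingNoise.integral_errorSum_sq_le (hN : IsDrivingNoise U W ν P)
    (hG : IsUnbiasedEstimate π G ν) (hb : LipschitzWith K (drift π)) (hC : 0 ≤ C)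
    (hHC : ∀ x, ∫⁻ u, ‖gradError π G x u‖ₑ ^ (2 : ℝ) ∂ν ≤ ENNReal.ofReal (C * (1 + ‖x‖ ^ 2)))
    (m : ℕ) : ∫ ω, ‖errorSum π G θ₀ δ U W m ω‖ ^ 2 ∂P ≤
      ∑ k ∈ Finset.range m, (1 / 2 * δ k) ^ 2 *
        (C * (1 + ∫ ω, ‖sgld G θ₀ δ U W k ω‖ ^ 2 ∂P)) := by
  have hgm := (continuous_gradLog hb).measurable
  induction m with
  | zero => simp [errorSum]
  | succ m ih =>
    obtain ⟨h1, h2⟩ := hN.memLp_gradError (δ := δ) (θ₀ := θ₀) (k := m) hG hb hC hHC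
      (hN.memLp_sgld hG hb hC hHC m)
    have hM := hN.measurable_errorSum (θ₀ := θ₀) (δ := δ) hG.measurable hgm m
    have hθ := hN.measurable_sgld (θ₀ := θ₀) (δ := δ) hG.measurable m
    simp_rw [errorSum_succ]
    rw [integral_norm_add_smul_sq _ (measurable_gradError hG.measurable hgm)
      hG.integrable_gradError hG.integral_gradError (hθ.mono (hN.filtration.le m) le_rfl)
      (hN.measurable m) (hN.law m) (hM.mono (hN.filtration.le m) le_rfl)
      (hN.memLp_errorSum hG hb hC hHC m) h1 (hN.indepFun m (Measurable.prodMk hM hθ)),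
      Finset.sum_range_succ]
    gcongr

/-- The second moments of the SGLD chain are bounded uniformly in the step-sizes. -/
theorem IsDrivingNoise.exists_integral_sgld_sq_le (W : ℝ≥0 → Ω → EuclideanSpace ℝ (Fin d))
    (P : Measure Ω) [IsProbabilityMeasure P] (θ₀ : EuclideanSpace ℝ (Fin d))
    (hG : IsUnbiasedEstimate π G ν) (hb : LipschitzWith K (drift π)) (hC : 0 ≤ C)
    (hHC : ∀ x, ∫⁻ u, ‖gradError π G x u‖ₑ ^ (2 : ℝ) ∂ν ≤ ENNReal.ofReal (C * (1 + ‖x‖ ^ 2)))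
    {T : ℝ} (hT : 0 ≤ T) : ∃ R, 0 ≤ R ∧ ∀ (U : ℕ → Ω → 𝒰) (_ : IsDrivingNoise U W ν P)
      (δ : ℕ → ℝ) (m : ℕ) (_ : ∀ k < m, 0 < δ k) (_ : ∑ k ∈ Finset.range m, δ k = T),
      ∀ k ≤ m, ∫ ω, ‖sgld G θ₀ δ U W k ω‖ ^ 2 ∂P ≤ R := by
  obtain ⟨B, hB, hbB⟩ := exists_norm_sq_le_of_lipschitz hb
  -- As `δ k ≤ T`, the drift contributes at most `B (1 + T) δ k` and the error at most `C T δ k`,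
  -- each times `1 + E‖θ_k‖²`. Inserting `E‖θ_k‖² ≤ 2 E‖Z_k‖² + 2dT` gives `c` and `β`.
  set A := B * (1 + T) + C * T with hA
  have hA0 : 0 ≤ A := by positivity
  set c := 1 + 2 * A
  set β := A * (1 + 2 * (d * T))
  refine ⟨2 * ((‖θ₀‖ ^ 2 + β * T) * Real.exp (c * T)) + 2 * (d * T), by positivity,
    fun U hN δ m hδ hsum ↦ ?_⟩
  have hgm := (continuous_gradLog hb).measurable
  have htime : ∀ k ≤ m, time δ k ≤ T := fun k hk ↦ by
    rw [← hsum]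
    exact time_mono hδ hk le_rfl
  have htime0 : ∀ k ≤ m, 0 ≤ time δ k := fun k hk ↦
    Finset.sum_nonneg fun j hj ↦ (hδ j ((Finset.mem_range.1 hj).trans_le hk)).le
  have hδT : ∀ k < m, δ k ≤ T := fun k hk ↦ by
    have h1 := htime (k + 1) hk
    have h2 := htime0 k hk.le
    have h3 : time δ (k + 1) = time δ k + δ k := Finset.sum_range_succ _ _
    linarith
  -- The filtration contains all of `W`, so Brownian increments are not centred given the past.
  -- Subtracting the Brownian path removes them from the recursion. Subtracting `W 0` as well makes
  -- `Z 0 = θ₀` hold everywhere.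
  let Z : ℕ → Ω → EuclideanSpace ℝ (Fin d) := fun k ω ↦
    sgld G θ₀ δ U W k ω - (W (time δ k).toNNReal ω - W 0 ω)
  have hL : ∀ k, MemLp (sgld G θ₀ δ U W k) 2 P := hN.memLp_sgld hG hb hC hHC
  have hWW : ∀ k, MemLp (fun ω ↦ W (time δ k).toNNReal ω - W 0 ω) 2 P := fun k ↦
    (hN.brownian.memLp_two _).sub (hN.brownian.memLp_two _)
  have hZL : ∀ k, MemLp (Z k) 2 P := fun k ↦ (hL k).sub (hWW k)
  have hWint : ∀ k ≤ m, ∫ ω, ‖W (time δ k).toNNReal ω - W 0 ω‖ ^ 2 ∂P ≤ d * T := fun k hk ↦ by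
    have h1 : ∫ ω, ‖W (time δ k).toNNReal ω - W 0 ω‖ ^ 2 ∂P =
        ∫ ω, ‖W (time δ k).toNNReal ω‖ ^ 2 ∂P := integral_congr_ae <| by
      filter_upwards [hN.brownian.ae_zero] with ω h
      rw [h, sub_zero]
    rw [h1, hN.brownian.integral_norm_sq, Real.coe_toNNReal _ (htime0 k hk)]
    exact mul_le_mul_of_nonneg_left (htime k hk) (by positivity)
  have hθZ : ∀ k ≤ m, ∫ ω, ‖sgld G θ₀ δ U W k ω‖ ^ 2 ∂P ≤
      2 * ∫ ω, ‖Z k ω‖ ^ 2 ∂P + 2 * (d * T) := fun k hk ↦ by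
    have hi1 := (hZL k).integrable_norm_pow two_ne_zero
    have hi2 := (hWW k).integrable_norm_pow two_ne_zero
    have h1 : ∫ ω, ‖sgld G θ₀ δ U W k ω‖ ^ 2 ∂P ≤
        ∫ ω, (2 * ‖Z k ω‖ ^ 2 + 2 * ‖W (time δ k).toNNReal ω - W 0 ω‖ ^ 2) ∂P := by
      refine integral_mono ((hL k).integrable_norm_pow two_ne_zero)
        ((hi1.const_mul _).add (hi2.const_mul _)) fun ω ↦ ?_
      have h2 : sgld G θ₀ δ U W k ω = Z k ω + (W (time δ k).toNNReal ω - W 0 ω) := by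
        simp [Z]
      have h3 := norm_add_le (Z k ω) (W (time δ k).toNNReal ω - W 0 ω)
      rw [← h2] at h3
      have h4 := pow_le_pow_left₀ (norm_nonneg _) h3 2
      simp only
      nlinarith [sq_nonneg (‖Z k ω‖ - ‖W (time δ k).toNNReal ω - W 0 ω‖)]
    rw [integral_add (hi1.const_mul _) (hi2.const_mul _), integral_const_mul,
      integral_const_mul] at h1
    linarith [hWint k hk]
  have hstep : ∀ k < m, ∫ ω, ‖Z (k + 1) ω‖ ^ 2 ∂P ≤
      (1 + c * δ k) * ∫ ω, ‖Z k ω‖ ^ 2 ∂P + β * δ k := fun k hk ↦ by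
    have hδk := hδ k hk
    obtain ⟨hH2, hHle⟩ := hN.memLp_gradError (δ := δ) (θ₀ := θ₀) (k := k) hG hb hC hHC (hL k)
    have hθ := hN.measurable_sgld (θ₀ := θ₀) (δ := δ) hG.measurable k
    have hd2 := memLp_two_comp_lipschitz hb (hL k)
    let Y : Ω → EuclideanSpace ℝ (Fin d) := fun ω ↦
      Z k ω + δ k • drift π (sgld G θ₀ δ U W k ω)
    have hY : Measurable[hN.filtration k] Y := by
      have h1 := hN.measurable_brownian_filtration k (time δ k).toNNReal
      have h2 := hN.measurable_brownian_filtration k 0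
      exact Measurable.add (Measurable.sub hθ (Measurable.sub h1 h2))
        (Measurable.const_smul (hb.continuous.measurable.comp hθ) (δ k))
    have hY2 : MemLp Y 2 P := (hZL k).add (hd2.const_smul (δ k))
    have hZsucc : ∀ ω, Z (k + 1) ω =
        Y ω + (1 / 2 * δ k) • gradError π G (sgld G θ₀ δ U W k ω) (U k ω) := fun ω ↦ by
      simp only [Z, Y, sgld_succ (π := π), sqrt_smul_noise _ hδk]
      abel
    simp_rw [hZsucc]
    rw [integral_norm_add_smul_sq _ (measurable_gradError hG.measurable hgm)
      hG.integrable_gradError hG.integral_gradError (hθ.mono (hN.filtration.le k) le_rfl)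
      (hN.measurable k) (hN.law k) (hY.mono (hN.filtration.le k) le_rfl) hY2 hH2
      (hN.indepFun k (Measurable.prodMk hY hθ))]
    have hi1 := (hZL k).integrable_norm_pow two_ne_zero
    have hi2 := (hL k).integrable_norm_pow two_ne_zero
    have hYle : ∫ ω, ‖Y ω‖ ^ 2 ∂P ≤ (1 + δ k) * ∫ ω, ‖Z k ω‖ ^ 2 ∂P +
        (δ k + δ k ^ 2) * (B * (1 + ∫ ω, ‖sgld G θ₀ δ U W k ω‖ ^ 2 ∂P)) := by
      have hi3 : Integrable (fun ω ↦ (δ k + δ k ^ 2) *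
          (B * (1 + ‖sgld G θ₀ δ U W k ω‖ ^ 2))) P :=
        (((integrable_const _).add hi2).const_mul _).const_mul _
      have h1 : ∫ ω, ‖Y ω‖ ^ 2 ∂P ≤ ∫ ω, ((1 + δ k) * ‖Z k ω‖ ^ 2 +
          (δ k + δ k ^ 2) * (B * (1 + ‖sgld G θ₀ δ U W k ω‖ ^ 2))) ∂P := by
        refine integral_mono (hY2.integrable_norm_pow two_ne_zero)
          ((hi1.const_mul _).add hi3) fun ω ↦ ?_
        refine (norm_add_smul_sq_le _ _ hδk.le).trans ?_
        have := hbB (sgld G θ₀ δ U W k ω)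
        gcongr
      rw [integral_add (hi1.const_mul _) hi3, integral_const_mul, integral_const_mul,
        integral_const_mul, integral_add (integrable_const _) hi2] at h1
      simpa using h1
    have hθk := hθZ k hk.le
    have hZ0 : 0 ≤ ∫ ω, ‖Z k ω‖ ^ 2 ∂P := integral_nonneg fun _ ↦ sq_nonneg _
    have hs0 : 0 ≤ ∫ ω, ‖sgld G θ₀ δ U W k ω‖ ^ 2 ∂P := integral_nonneg fun _ ↦ sq_nonneg _
    set z := ∫ ω, ‖Z k ω‖ ^ 2 ∂P
    set s := ∫ ω, ‖sgld G θ₀ δ U W k ω‖ ^ 2 ∂P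
    have hsq : δ k ^ 2 ≤ T * δ k := by nlinarith [hδT k hk]
    calc _ ≤ ((1 + δ k) * z + (δ k + δ k ^ 2) * (B * (1 + s))) +
          (1 / 2 * δ k) ^ 2 * (C * (1 + s)) := by gcongr
      _ ≤ ((1 + δ k) * z + (δ k + T * δ k) * (B * (1 + s))) + T * δ k * (C * (1 + s)) := by
        have : (1 / 2 * δ k) ^ 2 ≤ T * δ k := by nlinarith [sq_nonneg (δ k)]
        gcongr
      _ = (1 + δ k) * z + A * δ k * (1 + s) := by rw [hA]; ring
      _ ≤ (1 + δ k) * z + A * δ k * (1 + (2 * z + 2 * (d * T))) := by gcongr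
      _ = _ := by ring
  have hZ0 : ∫ ω, ‖Z 0 ω‖ ^ 2 ∂P = ‖θ₀‖ ^ 2 := by
    have : ∀ ω, Z 0 ω = θ₀ := fun ω ↦ by simp [Z, sgld, chain, time]
    simp [this]
  intro k hk
  have h1 := le_mul_exp_of_succ_le (u := fun k ↦ ∫ ω, ‖Z k ω‖ ^ 2 ∂P) (c := fun k ↦ c * δ k)
    (b := fun k ↦ β * δ k) (m := m) (integral_nonneg fun _ ↦ sq_nonneg _)
    (fun k hk ↦ by have := hδ k hk; positivity) (fun k hk ↦ by have := hδ k hk; positivity)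
    hstep k hk
  simp only [← Finset.mul_sum] at h1
  have h2 : ∑ j ∈ Finset.range k, δ j ≤ T := htime k hk
  have h3 := htime0 k hk
  rw [hZ0] at h1
  refine (hθZ k hk).trans ?_
  have h4 : (‖θ₀‖ ^ 2 + β * ∑ j ∈ Finset.range k, δ j) *
      Real.exp (c * ∑ j ∈ Finset.range k, δ j) ≤ (‖θ₀‖ ^ 2 + β * T) * Real.exp (c * T) := by
    gcongr
  linarith

/-- The accumulated gradient error is small in probability when the step-sizes are small. -/
theorem IsDrivingNoise.exists_measure_errorSum_le (W : ℝ≥0 → Ω → EuclideanSpace ℝ (Fin d))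
    (P : Measure Ω) [IsProbabilityMeasure P] (θ₀ : EuclideanSpace ℝ (Fin d))
    (hG : IsUnbiasedEstimate π G ν) (hb : LipschitzWith K (drift π)) (hC : 0 ≤ C)
    (hHC : ∀ x, ∫⁻ u, ‖gradError π G x u‖ₑ ^ (2 : ℝ) ∂ν ≤ ENNReal.ofReal (C * (1 + ‖x‖ ^ 2)))
    {T : ℝ} (hT : 0 ≤ T) : ∃ R, 0 ≤ R ∧ ∀ (U : ℕ → Ω → 𝒰) (_ : IsDrivingNoise U W ν P)
      (δ : ℕ → ℝ) (m : ℕ) (_ : ∀ k < m, 0 < δ k) (_ : ∑ k ∈ Finset.range m, δ k = T)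
      (h : ℝ) (_ : ∀ k < m, δ k ≤ h) (ε : ℝ) (_ : 0 < ε),
      P {ω | ∃ k ≤ m, ε ≤ ‖errorSum π G θ₀ δ U W k ω‖} ≤ ENNReal.ofReal (R * h / ε ^ 2) := by
  obtain ⟨R, hR, hmom⟩ := IsDrivingNoise.exists_integral_sgld_sq_le W P θ₀ hG hb hC hHC hT
  refine ⟨T * (C * (1 + R)), by positivity, fun U hN δ m hδ hsum h hh ε hε ↦ ?_⟩
  refine (measure_exists_le_norm_le (hN.submartingale_errorSum hG hb hC hHC) m hε).trans ?_
  refine ENNReal.ofReal_le_ofReal (div_le_div_of_nonneg_right ?_ (by positivity))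
  refine (hN.integral_errorSum_sq_le hG hb hC hHC m).trans ?_
  have h1 : ∀ k ∈ Finset.range m, (1 / 2 * δ k) ^ 2 *
      (C * (1 + ∫ ω, ‖sgld G θ₀ δ U W k ω‖ ^ 2 ∂P)) ≤ δ k * (h * (C * (1 + R))) := fun k hk ↦ by
    have hk := Finset.mem_range.1 hk
    have h2 := hmom U hN δ m hδ hsum k hk.le
    have h3 := hδ k hk
    have h4 := hh k hk
    -- One factor `δ k` is traded for the mesh bound `h`; the other sums to `T`.
    have h5 : (1 / 2 * δ k) ^ 2 ≤ δ k * h := by nlinarith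
    have h6 : 0 ≤ ∫ ω, ‖sgld G θ₀ δ U W k ω‖ ^ 2 ∂P := integral_nonneg fun _ ↦ sq_nonneg _
    have h7 : 0 ≤ δ k * h := mul_nonneg h3.le (h3.le.trans h4)
    rw [← mul_assoc (δ k)]
    gcongr
  refine (Finset.sum_le_sum h1).trans (le_of_eq ?_)
  rw [← Finset.sum_mul, hsum]
  ring

end Moments

theorem exists_mem_Icc_time (δ : ℕ → ℝ) {t : ℝ} (ht : 0 ≤ t) (n : ℕ) (hn : 0 < n)
    (h : t ≤ time δ n) : ∃ k < n, t ∈ Set.Icc (time δ k) (time δ (k + 1)) := by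
  induction n with
  | zero => omega
  | succ n ih =>
    rcases le_or_gt (time δ n) t with h1 | h1
    · exact ⟨n, by omega, h1, h⟩
    · rcases Nat.eq_zero_or_pos n with rfl | hn
      · simp [time] at h1
        linarith
      · obtain ⟨k, hk, hkt⟩ := ih hn h1.le
        exact ⟨k, by omega, hkt⟩

/-! ### Pathwise comparison with the diffusion -/

section Pathwise

variable {d : ℕ} {𝒰 Ω : Type*} {π : EuclideanSpace ℝ (Fin d) → ℝ}
  {G : EuclideanSpace ℝ (Fin d) → 𝒰 → EuclideanSpace ℝ (Fin d)}
  {θ₀ : EuclideanSpace ℝ (Fin d)} {δ : ℕ → ℝ} {U : ℕ → Ω → 𝒰}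
  {W : ℝ≥0 → Ω → EuclideanSpace ℝ (Fin d)} {K : ℝ≥0} {m : ℕ} {T h μ o : ℝ} {ω : Ω}
  {w x : PathSpace d T}

/-- Chain and `x` share their Brownian increments, which cancel. After removing the error sum, the
difference `e` moves on each step only by the integral of `b(θ_k) - b(x_s)`, where `‖θ_k - x_s‖ ≤ ‖e
k‖ + μ + o`; discrete Grönwall from `e 0 = 0` concludes. -/
theorem norm_sgld_sub_le (hT : 0 ≤ T) (hb : LipschitzWith K (drift π))
    (hδ : ∀ k < m, 0 < δ k) (hsum : ∑ k ∈ Finset.range m, δ k = T)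
    (hx : picard hT hb.continuous θ₀ w x = x)
    (hw : ∀ t : Set.Icc (0 : ℝ) T, w t = W (t : ℝ).toNNReal ω) (hW0 : W 0 ω = 0)
    (hμ : ∀ k ≤ m, ‖errorSum π G θ₀ δ U W k ω‖ ≤ μ) (hh : ∀ k < m, δ k ≤ h)
    (ho : ∀ s t : Set.Icc (0 : ℝ) T, |(s : ℝ) - t| ≤ h → ‖x s - x t‖ ≤ o)
    (hμ0 : 0 ≤ μ) (ho0 : 0 ≤ o) (k : ℕ) (hk : k ≤ m) :
    ‖sgld G θ₀ δ U W k ω - x (Set.projIcc 0 T hT (time δ k)) - errorSum π G θ₀ δ U W k ω‖ ≤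
      K * T * Real.exp (K * T) * (μ + o) := by
  have htime : ∀ k ≤ m, time δ k ∈ Set.Icc 0 T := fun k hk ↦
    ⟨Finset.sum_nonneg fun j hj ↦ (hδ j ((Finset.mem_range.1 hj).trans_le hk)).le,
      hsum ▸ time_mono hδ hk le_rfl⟩
  have hcx : Continuous fun s ↦ drift π (x (Set.projIcc 0 T hT s)) :=
    hb.continuous.comp (by fun_prop)
  have hxt : ∀ t (ht : t ∈ Set.Icc 0 T), x ⟨t, ht⟩ =
      θ₀ + (∫ s in (0 : ℝ)..t, drift π (x (Set.projIcc 0 T hT s))) + W t.toNNReal ω :=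
    fun t ht ↦ by
      conv_lhs => rw [← hx]
      rw [picard_apply, hw]
  set e : ℕ → EuclideanSpace ℝ (Fin d) := fun k ↦
    sgld G θ₀ δ U W k ω - x (Set.projIcc 0 T hT (time δ k)) - errorSum π G θ₀ δ U W k ω with he
  have hstep : ∀ k < m, ‖e (k + 1)‖ ≤ (1 + K * δ k) * ‖e k‖ + K * (μ + o) * δ k := fun k hk ↦ by
    have hk0 := htime k hk.le
    have hk1 := htime (k + 1) hk
    have hts : time δ (k + 1) = time δ k + δ k := Finset.sum_range_succ _ _
    have hδk := hδ k hk
    set θ := sgld G θ₀ δ U W k ω with hθ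
    have h1 : e (k + 1) = e k + ∫ s in time δ k..time δ (k + 1),
        (drift π θ - drift π (x (Set.projIcc 0 T hT s))) := by
      rw [intervalIntegral.integral_sub intervalIntegrable_const (hcx.intervalIntegrable _ _),
        intervalIntegral.integral_const, ← intervalIntegral.integral_interval_sub_left
        (hcx.intervalIntegrable 0 _) (hcx.intervalIntegrable 0 _)]
      simp only [he]
      rw [sgld_succ (π := π), errorSum_succ, sqrt_smul_noise _ hδk,
        Set.projIcc_of_mem hT hk0, Set.projIcc_of_mem hT hk1, hxt, hxt, ← hθ,
        show time δ (k + 1) - time δ k = δ k by rw [hts]; ring]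
      abel
    have h2 : ‖∫ s in time δ k..time δ (k + 1),
        (drift π θ - drift π (x (Set.projIcc 0 T hT s)))‖ ≤ K * (‖e k‖ + μ + o) * δ k := by
      refine (intervalIntegral.norm_integral_le_of_norm_le_const
        (C := K * (‖e k‖ + μ + o)) fun s hs ↦ ?_).trans (le_of_eq ?_)
      · rw [Set.uIoc_of_le (by linarith)] at hs
        have hsT : s ∈ Set.Icc 0 T := ⟨hk0.1.trans hs.1.le, hs.2.trans hk1.2⟩
        refine (hb.norm_sub_le _ _).trans (mul_le_mul_of_nonneg_left ?_ K.coe_nonneg)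
        have h3 : θ - x (Set.projIcc 0 T hT s) = e k + errorSum π G θ₀ δ U W k ω +
            (x (Set.projIcc 0 T hT (time δ k)) - x (Set.projIcc 0 T hT s)) := by
          simp only [he, hθ]
          abel
        rw [h3]
        refine (norm_add₃_le).trans (add_le_add (add_le_add le_rfl (hμ k hk.le)) (ho _ _ ?_))
        rw [Set.projIcc_of_mem hT hsT, Set.projIcc_of_mem hT hk0, abs_le]
        have := hh k hk
        constructor <;> simp only <;> linarith [hs.1, hs.2]
      · rw [hts, add_sub_cancel_left, abs_of_pos hδk]
    rw [h1]
    refine (norm_add_le _ _).trans ((add_le_add_right h2 _).trans (le_of_eq ?_))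
    ring
  have he0 : ‖e 0‖ = 0 := by
    have h0 : time δ 0 = 0 := rfl
    simp only [he, h0]
    rw [Set.projIcc_of_mem hT (Set.left_mem_Icc.2 hT), hxt]
    simp [hW0, errorSum, sgld, chain]
  have h1 := le_mul_exp_of_succ_le (u := fun k ↦ ‖e k‖) (c := fun k ↦ K * δ k)
    (b := fun k ↦ K * (μ + o) * δ k) (m := m) (norm_nonneg _)
    (fun k hk ↦ by have := hδ k hk; positivity) (fun k hk ↦ by have := hδ k hk; positivity)
    hstep k hk
  simp only [← Finset.mul_sum, he0, zero_add] at h1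
  have h2 := htime k hk
  have h3 : K * (μ + o) * ∑ j ∈ Finset.range k, δ j ≤ K * (μ + o) * T := by
    have := h2.2
    unfold time at this
    gcongr
  have h4 : Real.exp (K * ∑ j ∈ Finset.range k, δ j) ≤ Real.exp (K * T) := by
    have := h2.2
    unfold time at this
    gcongr
  refine h1.trans ((mul_le_mul h3 h4 (Real.exp_pos _).le (by positivity)).trans (le_of_eq ?_))
  ring

/-- The distance of the interpolated chain to the solution of the Langevin equation driven by the
same Brownian path is controlled by the gradient errors and the oscillation of the solution. -/
theorem dist_interpolation_le (hT : 0 < T) (hb : LipschitzWith K (drift π))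
    (hδ : ∀ k < m, 0 < δ k) (hsum : ∑ k ∈ Finset.range m, δ k = T)
    (hx : picard hT.le hb.continuous θ₀ w x = x)
    (hw : ∀ t : Set.Icc (0 : ℝ) T, w t = W (t : ℝ).toNNReal ω) (hW0 : W 0 ω = 0)
    (hμ : ∀ k ≤ m, ‖errorSum π G θ₀ δ U W k ω‖ ≤ μ) (hh : ∀ k < m, δ k ≤ h)
    (ho : ∀ s t : Set.Icc (0 : ℝ) T, |(s : ℝ) - t| ≤ h → ‖x s - x t‖ ≤ o)
    (hμ0 : 0 ≤ μ) (ho0 : 0 ≤ o) :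
    dist (interpolation T δ m fun k ↦ sgld G θ₀ δ U W k ω) x ≤
      (K * T * Real.exp (K * T) + 1) * (μ + o) := by
  have hA : 0 ≤ K * T * Real.exp (K * T) := by positivity
  refine (ContinuousMap.dist_le (by positivity)).2 fun t ↦ ?_
  have hm : 0 < m := by
    rcases Nat.eq_zero_or_pos m with rfl | h
    · simp at hsum; linarith
    · exact h
  obtain ⟨k, hk, hk1, hk2⟩ := exists_mem_Icc_time δ t.2.1 m hm (by
    rw [time, hsum]; exact t.2.2)
  have hts : time δ (k + 1) = time δ k + δ k := Finset.sum_range_succ _ _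
  have hδk := hδ k hk
  have hhk := hh k hk
  have htime : ∀ k ≤ m, time δ k ∈ Set.Icc 0 T := fun k hk ↦
    ⟨Finset.sum_nonneg fun j hj ↦ (hδ j ((Finset.mem_range.1 hj).trans_le hk)).le,
      hsum ▸ time_mono hδ hk le_rfl⟩
  -- Both grid points around `t` lie within `h` of it. The extra `+ 1` in the constant absorbs the
  -- error sum and the oscillation of `x` between grid point and `t`; convexity then handles the
  -- interpolation.
  have key : ∀ j ≤ m, |time δ j - t| ≤ h → ‖sgld G θ₀ δ U W j ω - x t‖ ≤
      (K * T * Real.exp (K * T) + 1) * (μ + o) := fun j hj hjt ↦ by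
    have h1 := norm_sgld_sub_le hT.le hb hδ hsum hx hw hW0 hμ hh ho hμ0 ho0 j hj
    have h2 := ho ⟨_, htime j hj⟩ t hjt
    rw [Set.projIcc_of_mem hT.le (htime j hj)] at h1
    have h3 : sgld G θ₀ δ U W j ω - x t =
        (sgld G θ₀ δ U W j ω - x ⟨_, htime j hj⟩ - errorSum π G θ₀ δ U W j ω) +
        errorSum π G θ₀ δ U W j ω + (x ⟨_, htime j hj⟩ - x t) := by abel
    rw [h3]
    refine norm_add₃_le.trans ?_
    linarith [hμ j hj]
  set r := (time δ (k + 1) - t) / δ k with hr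
  have hr0 : 0 ≤ r := div_nonneg (by linarith) hδk.le
  have hr1 : r ≤ 1 := by rw [hr, div_le_one hδk]; linarith
  have hrt : r * time δ k + (1 - r) * time δ (k + 1) = t := by
    rw [hts] at hr ⊢
    rw [hr]
    field_simp
    ring
  have h1 := interpolation_apply (T := T) (fun k ↦ sgld G θ₀ δ U W k ω) hδ hk ⟨hr0, hr1⟩
    (by rw [hrt]; exact t.2)
  have h2 : (⟨r * time δ k + (1 - r) * time δ (k + 1), by rw [hrt]; exact t.2⟩ :
      Set.Icc (0 : ℝ) T) = t := Subtype.ext hrt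
  rw [h2] at h1
  rw [h1, dist_eq_norm]
  have h3 : r • sgld G θ₀ δ U W k ω + (1 - r) • sgld G θ₀ δ U W (k + 1) ω - x t =
      r • (sgld G θ₀ δ U W k ω - x t) + (1 - r) • (sgld G θ₀ δ U W (k + 1) ω - x t) := by
    module
  rw [h3]
  have h4 := key k hk.le (by rw [abs_le]; constructor <;> linarith)
  have h5 := key (k + 1) hk (by rw [abs_le]; constructor <;> linarith)
  refine (norm_add_le _ _).trans ?_
  rw [norm_smul, norm_smul, Real.norm_of_nonneg hr0, Real.norm_of_nonneg (by linarith)]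
  nlinarith [mul_le_mul_of_nonneg_left h4 hr0,
    mul_le_mul_of_nonneg_left h5 (show 0 ≤ 1 - r by linarith)]

end Pathwise

theorem le_mesh {δ : ℕ → ℝ} {m k : ℕ} (hk : k < m) : δ k ≤ mesh δ m :=
  le_ciSup (f := fun j : Fin m ↦ δ j) (Set.finite_range _).bddAbove ⟨k, hk⟩

theorem measurable_interpolation {d : ℕ} {Ω : Type*} [MeasurableSpace Ω] {T : ℝ} (hT : 0 ≤ T)
    (δ : ℕ → ℝ) (m : ℕ) {θ : ℕ → Ω → EuclideanSpace ℝ (Fin d)} (hθ : ∀ k, Measurable (θ k)) :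
    Measurable fun ω ↦ interpolation T δ m fun k ↦ θ k ω := by
  refine (measurable_pathSpace_iff hT).2 fun t ↦ ?_
  change Measurable fun ω ↦ θ 0 ω + ∑ k ∈ Finset.range m,
    (max 0 (min 1 (((t : ℝ) - time δ k) / δ k))) • (θ (k + 1) ω - θ k ω)
  refine (hθ 0).add (Finset.measurable_fun_sum _ fun k _ ↦ ?_)
  have h : Measurable fun ω ↦ θ (k + 1) ω - θ k ω := (hθ (k + 1)).sub (hθ k)
  exact h.const_smul (max 0 (min 1 (((t : ℝ) - time δ k) / δ k)))

/-- Along vanishing step-sizes and gradient errors the interpolated chains converge uniformly. -/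
theorem tendsto_interpolation {d : ℕ} {𝒰 Ω : Type*} {π : EuclideanSpace ℝ (Fin d) → ℝ}
    {G : EuclideanSpace ℝ (Fin d) → 𝒰 → EuclideanSpace ℝ (Fin d)}
    {θ₀ : EuclideanSpace ℝ (Fin d)} {W : ℝ≥0 → Ω → EuclideanSpace ℝ (Fin d)} {K : ℝ≥0}
    {T : ℝ} (hT : 0 < T) (hb : LipschitzWith K (drift π)) {m : ℕ → ℕ} {δ : ℕ → ℕ → ℝ}
    (hδ : ∀ r, ∀ k < m r, 0 < δ r k) (hsum : ∀ r, ∑ k ∈ Finset.range (m r), δ r k = T)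
    (hmesh : Tendsto (fun r ↦ mesh (δ r) (m r)) atTop (𝓝 0)) {U : ℕ → ℕ → Ω → 𝒰} {ω : Ω}
    {w x : PathSpace d T} (hx : picard hT.le hb.continuous θ₀ w x = x)
    (hw : ∀ t : Set.Icc (0 : ℝ) T, w t = W (t : ℝ).toNNReal ω) (hW0 : W 0 ω = 0) {μ : ℕ → ℝ}
    (hμ : ∀ r, ∀ k ≤ m r, ‖errorSum π G θ₀ (δ r) (U r) W k ω‖ ≤ μ r)
    (hμ0 : Tendsto μ atTop (𝓝 0)) :
    Tendsto (fun r ↦ interpolation T (δ r) (m r) fun k ↦ sgld G θ₀ (δ r) (U r) W k ω)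
      atTop (𝓝 x) := by
  rw [Metric.tendsto_atTop']
  intro ε hε
  set A := K * T * Real.exp (K * T) + 1 with hA
  have hA0 : 0 < A := by positivity
  -- With oscillation and gradient error each at most `ε / (4A)`, the final bound is `ε / 2`.
  obtain ⟨η, hη, hη'⟩ := Metric.uniformContinuous_iff.1
    (CompactSpace.uniformContinuous_of_continuous x.continuous) (ε / (4 * A)) (by positivity)
  have h1 := (hmesh.eventually_lt_const hη).and
    (hμ0.eventually_lt_const (show 0 < ε / (4 * A) by positivity))
  obtain ⟨N, hN⟩ := eventually_atTop.1 h1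
  refine ⟨N, fun r hr ↦ ?_⟩
  obtain ⟨h2, h3⟩ := hN r hr.le
  refine (dist_interpolation_le (o := ε / (4 * A)) (h := mesh (δ r) (m r)) hT hb (hδ r) (hsum r)
    hx hw hW0 (hμ r) (fun k hk ↦ le_mesh hk) (fun s t hst ↦ ?_)
    ((norm_nonneg _).trans (hμ r 0 (Nat.zero_le _))) (by positivity)).trans_lt ?_
  · rw [← dist_eq_norm]
    exact (hη' (hst.trans_lt h2)).le
  · rw [← hA]
    have h4 : A * (μ r + ε / (4 * A)) < A * (ε / (4 * A) + ε / (4 * A)) := by gcongr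
    have h5 : A * (ε / (4 * A) + ε / (4 * A)) = ε / 2 := by field_simp; ring
    linarith

end SGLD

/-! ### Weak convergence -/

theorem theorem3 {d : ℕ} {𝒰 : Type*} [MeasurableSpace 𝒰]
    {Ω : Type*} [MeasurableSpace Ω] (P : Measure Ω) [IsProbabilityMeasure P]
    -- the target density, the stochastic gradient and the law of the auxiliary variables
    (π : EuclideanSpace ℝ (Fin d) → ℝ) (hπ : SGLD.IsPositiveDensity π)
    (ν : Measure 𝒰) [IsProbabilityMeasure ν]
    (G : EuclideanSpace ℝ (Fin d) → 𝒰 → EuclideanSpace ℝ (Fin d))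
    (hG : SGLD.IsUnbiasedEstimate π G ν)
    (hStab : SGLD.StabilityAssumption π G ν)
    (hLip : ∃ K : ℝ≥0, LipschitzWith K (SGLD.drift π))
    -- the step-sizes
    (T : ℝ) (hT : 0 < T) (m : ℕ → ℕ) (δ : ℕ → ℕ → ℝ)
    (hδ : ∀ r, ∀ k < m r, 0 < δ r k)
    (hsum : ∀ r, ∑ k ∈ Finset.range (m r), δ r k = T)
    (hmesh : Tendsto (fun r ↦ SGLD.mesh (δ r) (m r)) atTop (𝓝 0))
    -- the Brownian motion and the auxiliary variables
    (W : ℝ≥0 → Ω → EuclideanSpace ℝ (Fin d)) (hW : SGLD.IsStandardBM W P)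
    (U : ℕ → ℕ → Ω → 𝒰) (hUmeas : ∀ r k, Measurable (U r k))
    (hUlaw : ∀ r k, P.map (U r k) = ν)
    (hUindep : iIndepFun (fun p : ℕ × ℕ ↦ U p.1 p.2) P)
    (hUW : IndepFun (fun (ω : Ω) (p : ℕ × ℕ) ↦ U p.1 p.2 ω) (fun (ω : Ω) (t : ℝ≥0) ↦ W t ω) P)
    (θ₀ : EuclideanSpace ℝ (Fin d)) :
    -- the Langevin diffusion exists
    (∃ X : Ω → SGLD.PathSpace d T, SGLD.IsLangevinDiffusion π θ₀ T hT.le P W X) ∧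
    -- and the interpolated chains converge weakly to it, on whatever space it is realised
    ∀ (Ω' : Type*) [MeasurableSpace Ω'] (P' : Measure Ω') [IsProbabilityMeasure P']
      (W' : ℝ≥0 → Ω' → EuclideanSpace ℝ (Fin d)) (X' : Ω' → SGLD.PathSpace d T),
      SGLD.IsLangevinDiffusion π θ₀ T hT.le P' W' X' →
      TendstoInDistribution
        (fun r ω ↦ SGLD.interpolation T (δ r) (m r)
          (SGLD.chain G θ₀ (δ r) (fun k ↦ U r k ω) (SGLD.noise (fun t ↦ W t ω) (δ r))))
        atTop X' (fun _ ↦ P) P' := by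
  obtain ⟨K, hb⟩ := hLip
  obtain ⟨-, -, V, hV⟩ := hStab
  obtain ⟨C, hC, hHC⟩ := hV.exists_lintegral_gradError_le hG
  have hN : ∀ r, SGLD.IsDrivingNoise (U r) W ν P := fun r ↦
    { brownian := hW
      measurable := hUmeas r
      law := hUlaw r
      indep := hUindep.precomp (g := fun k : ℕ ↦ (r, k)) (Prod.mk_right_injective r)
      indep_brownian := hUW.comp (φ := fun (y : ℕ × ℕ → 𝒰) (k : ℕ) ↦ y (r, k)) (by fun_prop)
        measurable_id }
  obtain ⟨w, hwm, hw⟩ := hW.exists_path hT.le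
  have hX := SGLD.isLangevinDiffusion_solutionMap hW θ₀ hT.le hb hwm hw
  refine ⟨⟨_, hX⟩, fun Ω' _ P' _ W' X' hX' ↦ ?_⟩
  obtain ⟨R, hR, hM⟩ := SGLD.IsDrivingNoise.exists_measure_errorSum_le W P θ₀ hG hb hC hHC hT.le
  -- The running maximum of the error over `k ≤ m r`; Doob's inequality sends it to `0` in
  -- probability.
  let μ : ℕ → Ω → ℝ := fun r ω ↦ (Finset.range (m r + 1)).sup' Finset.nonempty_range_add_one
    fun k ↦ ‖SGLD.errorSum π G θ₀ (δ r) (U r) W k ω‖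
  have hμ : TendstoInMeasure P μ atTop 0 := by
    rw [tendstoInMeasure_iff_norm]
    intro ε hε
    have h0 : Tendsto (fun r ↦ ENNReal.ofReal (R * SGLD.mesh (δ r) (m r) / ε ^ 2)) atTop (𝓝 0) := by
      have := ENNReal.tendsto_ofReal ((hmesh.const_mul R).div_const (ε ^ 2))
      simpa using this
    refine tendsto_of_tendsto_of_tendsto_of_le_of_le tendsto_const_nhds h0 (fun _ ↦ zero_le)
      fun r ↦ ?_
    refine (measure_mono fun ω hω ↦ ?_).trans (hM (U r) (hN r) (δ r) (m r) (hδ r) (hsum r) _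
      (fun k hk ↦ SGLD.le_mesh hk) ε hε)
    have hμ0 : 0 ≤ μ r ω := (norm_nonneg _).trans (Finset.le_sup'
      (fun k ↦ ‖SGLD.errorSum π G θ₀ (δ r) (U r) W k ω‖) (Finset.mem_range.2 (Nat.succ_pos _)))
    have hω' : ε ≤ μ r ω := by simpa [abs_of_nonneg hμ0] using hω
    obtain ⟨k, hk, hkε⟩ := (Finset.le_sup'_iff _).1 hω'
    exact ⟨k, Nat.lt_succ_iff.1 (Finset.mem_range.1 hk), hkε⟩
  have hSm : ∀ r, AEMeasurable (fun ω ↦ SGLD.interpolation T (δ r) (m r)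
      fun k ↦ SGLD.sgld G θ₀ (δ r) (U r) W k ω) P := fun r ↦
    (SGLD.measurable_interpolation hT.le (δ r) (m r) fun k ↦
      SGLD.measurable_sgld hG.measurable hW.measurable k fun j _ ↦ hUmeas r j).aemeasurable
  refine ⟨hSm, hX'.measurable.aemeasurable, ?_⟩
  -- Uniqueness in law replaces `X'` by the solution driven by the chain's own `W`, where a pathwise
  -- comparison is possible.
  have hlaw : (⟨P'.map X', Measure.isProbabilityMeasure_map hX'.measurable.aemeasurable⟩ :
      ProbabilityMeasure (SGLD.PathSpace d T)) =
      ⟨P.map _, Measure.isProbabilityMeasure_map hX.measurable.aemeasurable⟩ :=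
    Subtype.ext (hX'.map_eq hb hX)
  rw [hlaw]
  -- Convergence in measure gives almost sure convergence only along a further subsequence. That
  -- suffices, since convergence of laws is convergence in a topology.
  refine tendsto_of_subseq_tendsto fun ns hns ↦ ?_
  obtain ⟨ms, hms, hae⟩ := (hμ.comp hns).exists_seq_tendsto_ae'
  refine ⟨ms, TendstoInDistribution.tendsto (Ω := fun _ ↦ Ω) (μ := fun _ ↦ P) (μ' := P)
    (tendstoInDistribution_of_ae_tendsto (fun r ↦ hSm (ns (ms r))) hX.measurable.aemeasurable ?_)⟩
  filter_upwards [hae, hw, hW.ae_zero] with ω h1 h2 h3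
  refine SGLD.tendsto_interpolation (U := fun r ↦ U (ns (ms r))) (μ := fun r ↦ μ (ns (ms r)) ω)
    hT hb (fun r ↦ hδ (ns (ms r))) (fun r ↦ hsum (ns (ms r))) (hmesh.comp (hns.comp hms))
    (SGLD.picard_solutionMap hT.le hb θ₀ (w ω)) h2 h3 (fun r k hk ↦ ?_) h1
  exact Finset.le_sup' (fun k ↦ ‖SGLD.errorSum π G θ₀ (δ (ns (ms r))) (U (ns (ms r))) W k ω‖)
    (Finset.mem_range.2 (Nat.lt_succ_of_le hk))
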